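/- Let $S=\{O,A,B,AB,BA\}$, with service rates $\gamma_O=3$, $\gamma_A=\gamma_B=10$, $\gamma_{AB}=\gamma_{BA}=2$; $e_a$ ($a\in S$) are the basis vectors of $\mathbb Z^5$. **The non-linear Markov process $\nabla_\infty$.** For a probability measure $p$ on $\mathbb Z_+^5$ put $\lambda_a=\gamma_a\,p\{x_a>0\}$ for $a=O,AB,BA$, $\lambda_A=\gamma_A\,p\{x_A>0,x_{BA}=0\}$, $\lambda_B=\gamma_B\,p\{x_B>0,x_{AB}=0\}$, and let the arrival rates be $\beta_O=\lambda_{AB}+\lambda_{BA}$, $\beta_A=\beta_B=\lambda_O/2$, $\beta_{AB}=\lambda_A$, $\beta_{BA}=\lambda_B$. Let $c_a(x)=\gamma_a$ if class $a$ is in service at $x$ (that is, $x_a>0$, and moreover $x_{BA}=0$ if $a=A$, $x_{AB}=0$ if $a=B$), and $c_a(x)=0$ otherwise. A family $p_t$, $t\ge0$, of probability measures on $\mathbb Z_+^5$ is a trajectory of the process if for all $t\ge 0$ and $x\in\mathbb Z^5_+$ $$\frac{d p_t(x)}{dt}=-p_t(x)\sum_a\big(\beta_a(t)+c_a(x)\big)+\sum_{a:\,x_a>0}p_t(x-e_a)\beta_a(t)+\sum_a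 p_t(x+e_a)\,c_a(x+e_a),$$ where $\beta_a(t)$ are the arrival rates of $p_t$. The trajectory $\nu^N(t)$ of $\nabla^N_\infty$ is such a family scaled in space: $\nu^N(t)$ is the image of $p_t$ under $x\mapsto x/N$, a probability measure on $(\frac1N\mathbb Z^5)^+\subset(\mathbb R^5)^+$. **The fluid system $\Delta_\infty$ on $[0,T]$.** For $\gamma,x_0\in\mathbb R$ and a function $Y$ let $V(t)=x_0+Y(t)-\gamma t$ and $W(\gamma,x_0,Y)(t)=V(t)+\max\{0,-\inf_{s\in[0,t]}V(s)\}$. Given net inflows $\bar Y=(Y_a)_{a\in S}$, which are non-decreasing and Lipschitz on $[0,T]$ with $Y_a(0)=0$, the trajectory $\bar x(t)$ of the open network $\Delta(\bar Y)$ started from $\bar x\in(\mathbb R^5)^+$ is $$x_O(\cdot)=W(3,x_O,Y_O),\qquad x_{BA}(\cdot)=W(2,x_{BA},Y_{BA}),\qquad x_A(\cdot)=W(10,5x_{BA}+x_A,5Y_{BA}+Y_A)-5x_{BA}(\cdot),$$ and symmetrically for $x_{AB},x_B$ (interchange $A\leftrightarrow B$, $AB\leftrightarrow BA$). The net outflows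 are $Z^{\bar x,\bar Y}_a(t)=x_a+Y_a(t)-x_a(t)$. A family $\mu(t)$, $t\in[0,T]$, of probability measures on $(\mathbb R^5)^+$ is a trajectory of $\Delta_\infty$ if there is such a $\bar Y$ for which $\mu(t)$ is the image of $\mu(0)$ under $\bar x\mapsto\bar x(t)$ for every $t\in[0,T]$, and for all $t\in[0,T]$ (the integrands being integrable) $$Y_O=\int (Z_{AB}+Z_{BA})\,d\mu(0),\quad Y_A=Y_B=\tfrac12\int Z_O\,d\mu(0),\quad Y_{AB}=\int Z_A\,d\mu(0),\quad Y_{BA}=\int Z_B\,d\mu(0).$$ **The distance.** $\rho_{KROV}(\mu,\mu')=\inf_\kappa\int\sum_{a\in S}|x_a-x_a'|\,d\kappa(x,x')$, the infimum being over all couplings $\kappa$ of $\mu$ and $\mu'$. **Theorem 5.1 (Euler scaling limit).** Let $T\ge0$. For every $N\ge1$ let $\nu^N(t)$, $t\ge0$, be a trajectory of $\nabla^N_\infty$, and suppose that $\rho_{KROV}(\nu^N(0),\mu)\to0$ as $N\to\infty$ for some probability measure $\mu$. Let $\mu(t)$, $t\in[0,T]$, be a KROV-limit point of the sequence of time-rescaled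 trajectories $\tilde\nu^N(t)=\nu^N(Nt)$, $t\in[0,T]$: for some $N_1<N_2<\dots$ we have $\rho_{KROV}(\tilde\nu^{N_k}(t),\mu(t))\to0$ as $k\to\infty$ for every $t\in[0,T]$. Then $\mu(0)=\mu$, and $\mu(t)$, $t\in[0,T]$, is a trajectory of the fluid system $\Delta_\infty$. -/

import Mathlib

open MeasureTheory Set Filter Topology
open scoped ENNReal NNReal

noncomputable section

namespace EulerLimit

/-- The five classes of customers (fluids). Class `O` sits at the node `Ō`, classes `A`, `BA` at the
node `Ā`, classes `B`, `AB` at the node `B̄`. -/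
inductive Species : Type
  | O | A | B | AB | BA
  deriving DecidableEq

open Species

instance : Fintype Species := ⟨{O, A, B, AB, BA}, by intro a; cases a <;> simp⟩

/-- Service rates. -/
def rate : Species → ℝ
  | O => 3
  | A => 10
  | B => 10
  | AB => 2
  | BA => 2

/-- Queue lengths of one elementary network: a point of the lattice `ℤ⁵₊`. -/
abbrev Config : Type := Species → ℕ

/-- Scaled queue lengths, or fluid levels. -/
abbrev State : Type := Species → ℝ

/-- The closed positive orthant `(ℝ⁵)⁺`. -/
def orthant : Set State := {x | ∀ a, 0 ≤ x a}

/-! ### The non-linear Markov process -/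

/-- The configurations in which some customer of class `a` is being served: `AB` has preemptive
priority over `B` at the node `B̄`, and `BA` over `A` at the node `Ā`. -/
def busy : Species → Set Config
  | O => {x | 0 < x O}
  | A => {x | 0 < x A ∧ x BA = 0}
  | B => {x | 0 < x B ∧ x AB = 0}
  | AB => {x | 0 < x AB}
  | BA => {x | 0 < x BA}

open Classical in
/-- Rate at which the customers of class `a` leave their node in the configuration `x`. -/
def exitRate (a : Species) (x : Config) : ℝ := if x ∈ busy a then rate a else 0

/-- Mean exit rate of class `a` in the state `p`, i.e. the quantity `λ_a`. -/
def meanExit (p : Measure Config) (a : Species) : ℝ := rate a * p.real (busy a)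

/-- Rates of the Poisson inflows of the five classes in the state `p`: customers `O` come from `AB`
and `BA`, customers `A` and `B` from `O` with probability `1/2` each, `AB` from `A`, `BA` from `B`. -/
def arrivalRate (p : Measure Config) : Species → ℝ
  | O => meanExit p AB + meanExit p BA
  | A => meanExit p O / 2
  | B => meanExit p O / 2
  | AB => meanExit p A
  | BA => meanExit p B

/-- Right-hand side at `x` of the (non-linear) Kolmogorov forward equation of the process. -/
def forwardRHS (p : Measure Config) (x : Config) : ℝ :=
  -(p.real {x} * ∑ a, arrivalRate p a) - p.real {x} * ∑ a, exitRate a x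
    + ∑ a, (if 0 < x a then p.real {x - Pi.single a 1} * arrivalRate p a else 0)
    + ∑ a, p.real {x + Pi.single a 1} * exitRate a (x + Pi.single a 1)

/-- `p t`, `t ≥ 0`, is a trajectory of the non-linear Markov process on probability measures on the
lattice `ℤ⁵₊` (queue lengths not scaled). Values of `p` at negative times are irrelevant. -/
def IsNLMP (p : ℝ → ProbabilityMeasure Config) : Prop :=
  ∀ t, 0 ≤ t → ∀ x : Config,
    HasDerivWithinAt (fun s => (p s : Measure Config).real {x})
      (forwardRHS (p t : Measure Config) x) (Ici 0) t

/-- The law of `x / N` when `x` has the law `p`: a probability measure on `(1/N) ℤ⁵₊`. -/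
def scaled (N : ℕ) (p : ProbabilityMeasure Config) : ProbabilityMeasure State :=
  p.map (f := fun x a => (x a : ℝ) / N) Measurable.of_discrete.aemeasurable

/-! ### The Kantorovich-Rubinstein-Ornstein-Vaserstein distance -/

/-- The KROV distance on probability measures for the metric `∑ |x_a - y_a|`; the value `∞` is
possible for measures without first moment. -/
def krov (μ ν : ProbabilityMeasure State) : ℝ≥0∞ :=
  ⨅ κ ∈ {κ : Measure (State × State) | κ.map Prod.fst = μ ∧ κ.map Prod.snd = ν},
    ∫⁻ z, ∑ a, edist (z.1 a) (z.2 a) ∂κ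

/-- `m` is a KROV-limit point, as `N → ∞`, of the sequence of trajectories `ν N` on `[0, T]`. The
convergence along the subsequence is only required at every fixed time. -/
def IsLimitPoint (T : ℝ) (ν : ℕ → ℝ → ProbabilityMeasure State) (m : ℝ → ProbabilityMeasure State) :
    Prop :=
  ∃ φ : ℕ → ℕ, StrictMono φ ∧
    ∀ t ∈ Icc 0 T, Tendsto (fun k => krov (ν (φ k) t) (m t)) atTop (𝓝 0)

/-! ### The fluid model -/

/-- Virtual level `V(t) = x₀ + Y(t) - γ t` of a single-fluid node. -/
def virtualLevel (γ x₀ : ℝ) (Y : ℝ → ℝ) (t : ℝ) : ℝ := x₀ + Y t - γ * t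

/-- The fluid level `W(γ, x₀, Y)(t) = V(t) + U(t)`, where `U(t) = max {0, - inf_{s ∈ [0,t]} V(s)}` is
the unused service capacity. -/
def nodeLevel (γ x₀ : ℝ) (Y : ℝ → ℝ) (t : ℝ) : ℝ :=
  virtualLevel γ x₀ Y t + max 0 (-sInf (virtualLevel γ x₀ Y '' Icc 0 t))

/-- Level at time `t` of the fluids in the open network `Δ(Y)` with the net inflows `Y` and the
initial levels `x`. The heavy fluids `AB`, `BA` have priority; the factor `5` is `10 / 2`. -/
def fluidLevel (Y : Species → ℝ → ℝ) (x : State) (t : ℝ) : State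
  | O => nodeLevel 3 (x O) (Y O) t
  | A => nodeLevel 10 (5 * x BA + x A) (fun s => 5 * Y BA s + Y A s) t
      - 5 * nodeLevel 2 (x BA) (Y BA) t
  | B => nodeLevel 10 (5 * x AB + x B) (fun s => 5 * Y AB s + Y B s) t
      - 5 * nodeLevel 2 (x AB) (Y AB) t
  | AB => nodeLevel 2 (x AB) (Y AB) t
  | BA => nodeLevel 2 (x BA) (Y BA) t

/-- Net outflow `Z(t) = x(0) + Y(t) - x(t)` of the fluid `a`. -/
def outflow (Y : Species → ℝ → ℝ) (x : State) (t : ℝ) (a : Species) : ℝ :=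
  x a + Y a t - fluidLevel Y x t a

/-- Admissible net inflows on `[0, T]`. -/
structure IsNetInflow (T : ℝ) (Y : Species → ℝ → ℝ) : Prop where
  zero : ∀ a, Y a 0 = 0
  mono : ∀ a, MonotoneOn (Y a) (Icc 0 T)
  lipschitz : ∃ K : ℝ≥0, ∀ a, LipschitzOnWith K (Y a) (Icc 0 T)

/-- On `[0, T]` the net inflows `Y` satisfy the relations of the closed network in the mean over the
initial state `μ`. -/
structure IsClosedFlow (T : ℝ) (μ : ProbabilityMeasure State) (Y : Species → ℝ → ℝ) : Prop where
  integrable : ∀ t ∈ Icc 0 T, ∀ a, Integrable (fun x => outflow Y x t a) (μ : Measure State)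
  eq_O : ∀ t ∈ Icc 0 T, Y O t = ∫ x, (outflow Y x t AB + outflow Y x t BA) ∂(μ : Measure State)
  eq_A : ∀ t ∈ Icc 0 T, Y A t = 1 / 2 * ∫ x, outflow Y x t O ∂(μ : Measure State)
  eq_B : ∀ t ∈ Icc 0 T, Y B t = 1 / 2 * ∫ x, outflow Y x t O ∂(μ : Measure State)
  eq_AB : ∀ t ∈ Icc 0 T, Y AB t = ∫ x, outflow Y x t A ∂(μ : Measure State)
  eq_BA : ∀ t ∈ Icc 0 T, Y BA t = ∫ x, outflow Y x t B ∂(μ : Measure State)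

/-- `m t`, `t ∈ [0, T]`, is a trajectory of the non-linear fluid system `Δ_∞`: its states live on the
orthant, and it is the transport of `m 0` by some open network `Δ(Y)` whose inflows satisfy the
relations of the closed network. -/
def IsFluidTrajectory (T : ℝ) (m : ℝ → ProbabilityMeasure State) : Prop :=
  (∀ t ∈ Icc 0 T, ∀ᵐ x ∂(m t : Measure State), x ∈ orthant) ∧
  ∃ Y : Species → ℝ → ℝ, IsNetInflow T Y ∧ IsClosedFlow T (m 0) Y ∧
    ∀ t ∈ Icc 0 T, (m t : Measure State) = (m 0 : Measure State).map (fun x => fluidLevel Y x t)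

end EulerLimit

end

open EulerLimit

/-! The work at a node, counted with weights under which every stage of service removes it at a
constant speed, is a reflected process whose input is Poisson. A quadratic Lyapunov function
compares it with the deterministic reflection of its mean input, with an error `O(√t)`. The
priority classes are covered as well, since the total work at a node does not depend on the
priorities and the level of the heavy class is itself the work of a single-class node. So at time
`t` the process is `O(√t)`-close to the fluid network which is fed with the mean inflows of the
process and started from the same configuration; at the times `N t` the error is `O(√N)`, which the
scaling of space by `N` removes.

The scaled mean inflows are uniformly Lipschitz, hence converge uniformly along a subsequence, and
the fluid levels depend on the inflows and the initial state in a Lipschitz way. The limit satisfies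
the relations of the closed network because the mean departures of the process are close to the mean
outflows of the fluid.

The comparison needs deterministic initial configurations, but a trajectory starts from an arbitrary
law. From each initial configuration Picard iteration builds solutions of the forward equation of
total mass tending to one; mixed over the initial law they minorise the trajectory, and so exhaust
it. -/

noncomputable section

namespace EulerLimit

open Species

/-! ### The one-sided reflection -/

/-- The one-sided Skorokhod regulator: the least `c ≥ 0` for which `v + c` is nonnegative on
`[0, t]`. -/
def regulator (v : ℝ → ℝ) (t : ℝ) : ℝ := max 0 (-sInf (v '' Icc 0 t))

/-- The path `v` reflected at zero; `nodeLevel` is the reflection of `virtualLevel`. -/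
def reflected (v : ℝ → ℝ) (t : ℝ) : ℝ := v t + regulator v t

lemma nodeLevel_eq_reflected (γ x₀ : ℝ) (Y : ℝ → ℝ) :
    nodeLevel γ x₀ Y = reflected (virtualLevel γ x₀ Y) := rfl

lemma regulator_nonneg (v : ℝ → ℝ) (t : ℝ) : 0 ≤ regulator v t := le_max_left _ _

lemma neg_le_regulator {v : ℝ → ℝ} {s t : ℝ} (hv : BddBelow (v '' Icc 0 t)) (hs : s ∈ Icc 0 t) :
    -v s ≤ regulator v t :=
  (neg_le_neg (csInf_le hv ⟨s, hs, rfl⟩)).trans (le_max_right _ _)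

lemma regulator_le {v : ℝ → ℝ} {t c : ℝ} (ht : 0 ≤ t) (hc : 0 ≤ c)
    (h : ∀ s ∈ Icc 0 t, -v s ≤ c) : regulator v t ≤ c := by
  refine max_le hc (neg_le.1 (le_csInf ⟨v 0, 0, ⟨le_rfl, ht⟩, rfl⟩ ?_))
  rintro _ ⟨s, hs, rfl⟩
  exact neg_le.1 (h s hs)

lemma regulator_mono {v : ℝ → ℝ} {t z : ℝ} (hv : BddBelow (v '' Icc 0 z)) (ht : 0 ≤ t)
    (htz : t ≤ z) : regulator v t ≤ regulator v z :=
  regulator_le ht (regulator_nonneg _ _) fun _ hs => neg_le_regulator hv ⟨hs.1, hs.2.trans htz⟩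

lemma reflected_nonneg {v : ℝ → ℝ} {t : ℝ} (hv : BddBelow (v '' Icc 0 t)) (ht : 0 ≤ t) :
    0 ≤ reflected v t :=
  neg_le_iff_add_nonneg'.1 (neg_le_regulator hv (right_mem_Icc.2 ht))

lemma reflected_zero {v : ℝ → ℝ} (h : 0 ≤ v 0) : reflected v 0 = v 0 := by
  have : regulator v 0 = 0 := by
    refine le_antisymm (regulator_le le_rfl le_rfl fun s hs => ?_) (regulator_nonneg _ _)
    obtain rfl : s = 0 := le_antisymm hs.2 hs.1
    exact neg_nonpos.2 h
  rw [reflected, this, add_zero]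

lemma abs_regulator_sub_le {v v' : ℝ → ℝ} {t d : ℝ} (ht : 0 ≤ t)
    (hv : BddBelow (v '' Icc 0 t)) (hv' : BddBelow (v' '' Icc 0 t))
    (h : ∀ s ∈ Icc 0 t, |v s - v' s| ≤ d) : |regulator v t - regulator v' t| ≤ d := by
  have hd : 0 ≤ d := (abs_nonneg _).trans (h 0 ⟨le_rfl, ht⟩)
  have one_sided : ∀ {u u' : ℝ → ℝ}, BddBelow (u' '' Icc 0 t) →
      (∀ s ∈ Icc 0 t, |u s - u' s| ≤ d) → regulator u t - regulator u' t ≤ d := by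
    intro u u' hu' hd'
    rw [sub_le_iff_le_add']
    refine regulator_le ht (add_nonneg (regulator_nonneg u' t) hd) fun s hs => ?_
    linarith [neg_le_regulator hu' hs, neg_le_of_abs_le (hd' s hs)]
  exact abs_sub_le_iff.2 ⟨one_sided hv' h,
    one_sided hv fun s hs => (abs_sub_comm _ _).trans_le (h s hs)⟩

open scoped Pointwise in
lemma reflected_scale {v v' : ℝ → ℝ} {N : ℝ} (hN : 0 < N) (h : ∀ s, v' s = v (N * s) / N)
    (t : ℝ) : reflected v' t = reflected v (N * t) / N := by
  have himage : v' '' Icc 0 t = N⁻¹ • (v '' Icc 0 (N * t)) := by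
    have hIcc : Icc 0 (N * t) = (N * ·) '' Icc 0 t := by
      rw [image_mul_left_Icc' hN, mul_zero]
    rw [hIcc, image_image, ← image_smul, image_image]
    exact image_congr fun s _ => (h s).trans (div_eq_inv_mul _ _)
  have hreg : regulator v' t = regulator v (N * t) / N := by
    rw [regulator, regulator, himage, Real.sInf_smul_of_nonneg (inv_nonneg.2 hN.le), smul_eq_mul,
      ← max_div_div_right hN.le, zero_div, neg_div, div_eq_inv_mul]
  rw [reflected, reflected, h, hreg, add_div]

section Lipschitz

variable {v : ℝ → ℝ} {K : ℝ≥0} {t z : ℝ}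

lemma bddBelow_image_of_lipschitzOn (hv : LipschitzOnWith K v (Icc 0 t)) :
    BddBelow (v '' Icc 0 t) :=
  isCompact_Icc.bddBelow_image hv.continuousOn

lemma abs_sub_le_of_lipschitzOn (hv : LipschitzOnWith K v (Icc 0 z)) (ht : 0 ≤ t) {s : ℝ}
    (hs : s ∈ Icc t z) : |v s - v t| ≤ K * (s - t) := by
  have h := hv.dist_le_mul s ⟨ht.trans hs.1, hs.2⟩ t ⟨ht, hs.1.trans hs.2⟩
  rwa [Real.dist_eq, Real.dist_eq, abs_of_nonneg (sub_nonneg.2 hs.1)] at h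

lemma neg_le_neg_add_of_lipschitzOn (hv : LipschitzOnWith K v (Icc 0 z)) (ht : 0 ≤ t) {s : ℝ}
    (hs : s ∈ Icc t z) : -v s ≤ -v t + K * (z - t) := by
  have hincr := neg_le_of_abs_le (abs_sub_le_of_lipschitzOn hv ht hs)
  have hlen : K * (s - t) ≤ K * (z - t) := by gcongr; exact hs.2
  linarith

lemma regulator_sub_le (hv : LipschitzOnWith K v (Icc 0 z)) (ht : 0 ≤ t) (htz : t ≤ z) :
    regulator v z - regulator v t ≤ K * (z - t) := by
  have hbdd := bddBelow_image_of_lipschitzOn (hv.mono (Icc_subset_Icc_right htz))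
  have hpos : 0 ≤ K * (z - t) := mul_nonneg K.2 (sub_nonneg.2 htz)
  rw [sub_le_iff_le_add']
  refine regulator_le (ht.trans htz) (add_nonneg (regulator_nonneg v t) hpos) fun s hs => ?_
  rcases le_total s t with h | h
  · linarith [neg_le_regulator hbdd ⟨hs.1, h⟩]
  · linarith [neg_le_neg_add_of_lipschitzOn hv ht ⟨h, hs.2⟩,
      neg_le_regulator hbdd (right_mem_Icc.2 ht)]

/-- The regulator grows only where the reflected path is close to zero. -/
lemma reflected_mul_regulator_sub_le (hv : LipschitzOnWith K v (Icc 0 z)) (ht : 0 ≤ t)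
    (htz : t ≤ z) :
    reflected v t * (regulator v z - regulator v t)
      ≤ K * (z - t) * (regulator v z - regulator v t) := by
  have hbdd := bddBelow_image_of_lipschitzOn (hv.mono (Icc_subset_Icc_right htz))
  rcases (regulator_mono (bddBelow_image_of_lipschitzOn hv) ht htz).eq_or_lt with h | h
  · simp [h]
  refine mul_le_mul_of_nonneg_right ?_ (sub_nonneg.2 h.le)
  by_contra! hfar
  rw [reflected] at hfar
  refine h.not_ge (regulator_le (ht.trans htz) (regulator_nonneg _ _) fun s hs => ?_)
  rcases le_total s t with hst | hst
  · exact neg_le_regulator hbdd ⟨hs.1, hst⟩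
  · linarith [neg_le_neg_add_of_lipschitzOn hv ht ⟨hst, hs.2⟩]

lemma sq_sub_reflected_le {w : ℝ} (hv : LipschitzOnWith K v (Icc 0 z)) (ht : 0 ≤ t) (htz : t ≤ z)
    (hw : 0 ≤ w) :
    (w - reflected v z) ^ 2 ≤ (w - reflected v t) ^ 2
      - 2 * (w - reflected v t) * (v z - v t) + 6 * K ^ 2 * (z - t) ^ 2 := by
  have hcomp := reflected_mul_regulator_sub_le hv ht htz
  have hreg := regulator_sub_le hv ht htz
  have hv_incr := abs_le.1 (abs_sub_le_of_lipschitzOn hv ht ⟨htz, le_rfl⟩)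
  have hd : 0 ≤ regulator v z - regulator v t :=
    sub_nonneg.2 (regulator_mono (bddBelow_image_of_lipschitzOn hv) ht htz)
  have hrefl : reflected v z
      = reflected v t + ((v z - v t) + (regulator v z - regulator v t)) := by
    rw [reflected, reflected]; ring
  generalize regulator v z - regulator v t = d at *
  generalize he : K * (z - t) = e at *
  have hsq : ((v z - v t) + d) ^ 2 ≤ (2 * e) ^ 2 := sq_le_sq' (by linarith) (by linarith)
  calc (w - reflected v z) ^ 2
      = (w - reflected v t) ^ 2 - 2 * (w - reflected v t) * (v z - v t) - 2 * (w * d)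
        + 2 * (reflected v t * d) + ((v z - v t) + d) ^ 2 := by rw [hrefl]; ring
    _ ≤ (w - reflected v t) ^ 2 - 2 * (w - reflected v t) * (v z - v t) + 6 * e ^ 2 := by
        nlinarith [mul_nonneg hw hd, mul_le_mul_of_nonneg_left hreg (hd.trans hreg)]
    _ = _ := by rw [← he]; ring

lemma lipschitzOnWith_regulator (hv : LipschitzOnWith K v (Icc 0 t)) :
    LipschitzOnWith K (regulator v) (Icc 0 t) := by
  refine LipschitzOnWith.of_dist_le_mul fun s hs r hr => ?_
  wlog hsr : s ≤ r generalizing s r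
  · rw [dist_comm, dist_comm s]
    exact this r hr s hs (le_of_not_ge hsr)
  have hvr := hv.mono (Icc_subset_Icc_right hr.2)
  rw [dist_comm, Real.dist_eq, dist_comm, Real.dist_eq, abs_of_nonneg (sub_nonneg.2 hsr),
    abs_of_nonneg (sub_nonneg.2 (regulator_mono (bddBelow_image_of_lipschitzOn hvr) hs.1 hsr))]
  exact regulator_sub_le hvr hs.1 hsr

lemma continuousOn_reflected (hv : LipschitzOnWith K v (Icc 0 t)) :
    ContinuousOn (reflected v) (Icc 0 t) :=
  hv.continuousOn.add (lipschitzOnWith_regulator hv).continuousOn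

end Lipschitz

/-! ### The fluid network -/

lemma sum_species {M : Type*} [AddCommMonoid M] (f : Species → M) :
    ∑ a, f a = f O + f A + f B + f AB + f BA := by
  have : (Finset.univ : Finset Species) = {O, A, B, AB, BA} := rfl
  rw [this, Finset.sum_insert (by simp), Finset.sum_insert (by simp), Finset.sum_insert (by simp),
    Finset.sum_insert (by simp), Finset.sum_singleton]
  simp only [add_assoc]

/-- The `ℓ¹` distance on `ℝ⁵`, the ground metric of the KROV distance. -/
def dist1 (x y : State) : ℝ := ∑ a, |x a - y a|

lemma abs_sub_le_dist1 (x y : State) (a : Species) : |x a - y a| ≤ dist1 x y :=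
  Finset.single_le_sum (f := fun a => |x a - y a|) (fun _ _ => abs_nonneg _) (Finset.mem_univ a)

/-- The work `5 x_h + x_l` at a node with the heavy fluid `h` and the light fluid `l`, in units of
the light fluid, of which the node serves `10` per unit time whatever the priorities. -/
def nodeWork (Y : Species → ℝ → ℝ) (x : State) (h l : Species) : ℝ → ℝ :=
  nodeLevel 10 (5 * x h + x l) fun s => 5 * Y h s + Y l s

lemma fluidLevel_A (Y : Species → ℝ → ℝ) (x : State) (t : ℝ) :
    fluidLevel Y x t A = nodeWork Y x BA A t - 5 * fluidLevel Y x t BA := rfl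

lemma fluidLevel_B (Y : Species → ℝ → ℝ) (x : State) (t : ℝ) :
    fluidLevel Y x t B = nodeWork Y x AB B t - 5 * fluidLevel Y x t AB := rfl

lemma nodeLevel_scale {γ x₀ N : ℝ} (hN : 0 < N) {Y Y' : ℝ → ℝ} (h : ∀ s, Y' s = Y (N * s) / N)
    (t : ℝ) : nodeLevel γ (x₀ / N) Y' t = nodeLevel γ x₀ Y (N * t) / N := by
  refine reflected_scale hN (fun s => ?_) t
  simp only [virtualLevel, h]
  field_simp

lemma nodeWork_scale {N : ℝ} (hN : 0 < N) {Y Y' : Species → ℝ → ℝ}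
    (hY : ∀ a s, Y' a s = Y a (N * s) / N) (x : State) (h l : Species) (t : ℝ) :
    nodeWork Y' (fun a => x a / N) h l t = nodeWork Y x h l (N * t) / N := by
  have hx : 5 * (x h / N) + x l / N = (5 * x h + x l) / N := by ring
  rw [nodeWork, nodeWork, hx]
  exact nodeLevel_scale hN (fun s => by rw [hY, hY]; ring) t

lemma fluidLevel_scale {N : ℝ} (hN : 0 < N) {Y Y' : Species → ℝ → ℝ}
    (hY : ∀ a s, Y' a s = Y a (N * s) / N) (x : State) (t : ℝ) (a : Species) :
    fluidLevel Y' (fun a => x a / N) t a = fluidLevel Y x (N * t) a / N := by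
  have hAB : fluidLevel Y' (fun a => x a / N) t AB = fluidLevel Y x (N * t) AB / N :=
    nodeLevel_scale hN (hY AB) t
  have hBA : fluidLevel Y' (fun a => x a / N) t BA = fluidLevel Y x (N * t) BA / N :=
    nodeLevel_scale hN (hY BA) t
  cases a with
  | O => exact nodeLevel_scale hN (hY O) t
  | A => rw [fluidLevel_A, fluidLevel_A, nodeWork_scale hN hY, hBA]; ring
  | B => rw [fluidLevel_B, fluidLevel_B, nodeWork_scale hN hY, hAB]; ring
  | AB => exact hAB
  | BA => exact hBA

section Stability

variable {t d : ℝ}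

lemma bddBelow_virtualLevel {γ x₀ : ℝ} {Y : ℝ → ℝ} (hγ : 0 ≤ γ) (hY : ∀ s ∈ Icc 0 t, 0 ≤ Y s) :
    BddBelow (virtualLevel γ x₀ Y '' Icc 0 t) := by
  refine ⟨x₀ - γ * t, ?_⟩
  rintro _ ⟨s, hs, rfl⟩
  rw [virtualLevel]
  linarith [hY s hs, mul_le_mul_of_nonneg_left hs.2 hγ]

lemma abs_nodeLevel_sub_le {γ x y : ℝ} {Y Y' : ℝ → ℝ} (hγ : 0 ≤ γ) (ht : 0 ≤ t)
    (hY : ∀ s ∈ Icc 0 t, 0 ≤ Y s) (hY' : ∀ s ∈ Icc 0 t, 0 ≤ Y' s)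
    (hd : ∀ s ∈ Icc 0 t, |Y s - Y' s| ≤ d) :
    |nodeLevel γ x Y t - nodeLevel γ y Y' t| ≤ 2 * (|x - y| + d) := by
  have hvirtual : ∀ s ∈ Icc 0 t,
      |virtualLevel γ x Y s - virtualLevel γ y Y' s| ≤ |x - y| + d := fun s hs =>
    calc |virtualLevel γ x Y s - virtualLevel γ y Y' s|
        = |(x - y) + (Y s - Y' s)| := by rw [virtualLevel, virtualLevel]; ring_nf
      _ ≤ |x - y| + d := (abs_add_le _ _).trans (add_le_add_right (hd s hs) _)
  have hreg := abs_regulator_sub_le ht (bddBelow_virtualLevel (x₀ := x) hγ hY)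
    (bddBelow_virtualLevel (x₀ := y) hγ hY') hvirtual
  rw [nodeLevel_eq_reflected, nodeLevel_eq_reflected, reflected, reflected, add_sub_add_comm,
    two_mul]
  exact (abs_add_le _ _).trans (add_le_add (hvirtual t (right_mem_Icc.2 ht)) hreg)

lemma nodeLevel_deficit_mem {γ x₀ : ℝ} {Y : ℝ → ℝ} (ht : 0 ≤ t) (hγ : 0 ≤ γ) (hx₀ : 0 ≤ x₀)
    (hY : ∀ s ∈ Icc 0 t, 0 ≤ Y s) : x₀ + Y t - nodeLevel γ x₀ Y t ∈ Icc 0 (γ * t) := by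
  have hreg : regulator (virtualLevel γ x₀ Y) t ≤ γ * t :=
    regulator_le ht (mul_nonneg hγ ht) fun s hs => by
      rw [virtualLevel]
      linarith [hY s hs, mul_le_mul_of_nonneg_left hs.2 hγ]
  have hrefl : nodeLevel γ x₀ Y t = x₀ + Y t - γ * t + regulator (virtualLevel γ x₀ Y) t := rfl
  constructor <;> linarith [regulator_nonneg (virtualLevel γ x₀ Y) t]

lemma abs_five_mul_add_sub_le (u u' v v' : ℝ) :
    |5 * u + v - (5 * u' + v')| ≤ 5 * |u - u'| + |v - v'| :=
  calc |5 * u + v - (5 * u' + v')| = |5 * (u - u') + (v - v')| := by ring_nf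
    _ ≤ |5 * (u - u')| + |v - v'| := abs_add_le _ _
    _ = 5 * |u - u'| + |v - v'| := by rw [abs_mul, abs_of_pos (by norm_num : (0 : ℝ) < 5)]

section TwoInflows

variable {Y Y' : Species → ℝ → ℝ}

lemma abs_nodeWork_sub_le (ht : 0 ≤ t) (hY : ∀ a, ∀ s ∈ Icc 0 t, 0 ≤ Y a s)
    (hY' : ∀ a, ∀ s ∈ Icc 0 t, 0 ≤ Y' a s) (hd : ∀ a, ∀ s ∈ Icc 0 t, |Y a s - Y' a s| ≤ d)
    (x y : State) (h l : Species) :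
    |nodeWork Y x h l t - nodeWork Y' y h l t|
      ≤ 2 * (5 * |x h - y h| + |x l - y l| + 6 * d) := by
  have hle := abs_nodeLevel_sub_le (γ := 10) (x := 5 * x h + x l) (y := 5 * y h + y l) (d := 6 * d)
    (Y := fun s => 5 * Y h s + Y l s) (Y' := fun s => 5 * Y' h s + Y' l s) (by norm_num) ht
    (fun s hs => by linarith [hY h s hs, hY l s hs])
    (fun s hs => by linarith [hY' h s hs, hY' l s hs])
    (fun s hs => (abs_five_mul_add_sub_le _ _ _ _).trans (by linarith [hd h s hs, hd l s hs]))
  exact hle.trans (by linarith [abs_five_mul_add_sub_le (x h) (y h) (x l) (y l)])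

lemma dist1_fluidLevel_le (ht : 0 ≤ t) (hY : ∀ a, ∀ s ∈ Icc 0 t, 0 ≤ Y a s)
    (hY' : ∀ a, ∀ s ∈ Icc 0 t, 0 ≤ Y' a s) (hd : ∀ a, ∀ s ∈ Icc 0 t, |Y a s - Y' a s| ≤ d)
    (x y : State) : dist1 (fluidLevel Y x t) (fluidLevel Y' y t) ≤ 22 * dist1 x y + 50 * d := by
  have solo : ∀ (γ : ℝ) (a : Species), 0 ≤ γ →
      |nodeLevel γ (x a) (Y a) t - nodeLevel γ (y a) (Y' a) t| ≤ 2 * (|x a - y a| + d) :=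
    fun γ a hγ => abs_nodeLevel_sub_le hγ ht (hY a) (hY' a) (hd a)
  have hO : |fluidLevel Y x t O - fluidLevel Y' y t O| ≤ _ := solo 3 O (by norm_num)
  have hAB : |fluidLevel Y x t AB - fluidLevel Y' y t AB| ≤ _ := solo 2 AB (by norm_num)
  have hBA : |fluidLevel Y x t BA - fluidLevel Y' y t BA| ≤ _ := solo 2 BA (by norm_num)
  have light : ∀ {W W' X X' e e' : ℝ}, |W - W'| ≤ e → |X - X'| ≤ e' →
      |(W - 5 * X) - (W' - 5 * X')| ≤ e + 5 * e' := by
    intro W W' X X' e e' hW hX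
    rw [abs_le] at hW hX ⊢
    constructor <;> linarith
  have hA := light (abs_nodeWork_sub_le ht hY hY' hd x y BA A) hBA
  have hB := light (abs_nodeWork_sub_le ht hY hY' hd x y AB B) hAB
  simp only [dist1, sum_species, fluidLevel_A, fluidLevel_B]
  linarith [abs_nonneg (x O - y O), abs_nonneg (x A - y A), abs_nonneg (x B - y B)]

lemma abs_outflow_sub_le (ht : 0 ≤ t) (hY : ∀ a, ∀ s ∈ Icc 0 t, 0 ≤ Y a s)
    (hY' : ∀ a, ∀ s ∈ Icc 0 t, 0 ≤ Y' a s) (hd : ∀ a, ∀ s ∈ Icc 0 t, |Y a s - Y' a s| ≤ d)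
    (x y : State) (a : Species) :
    |outflow Y x t a - outflow Y' y t a| ≤ 23 * dist1 x y + 51 * d := by
  have hx := abs_le.1 (abs_sub_le_dist1 x y a)
  have hYt := abs_le.1 (hd a t (right_mem_Icc.2 ht))
  have hlevel := abs_le.1 ((abs_sub_le_dist1 _ _ a).trans (dist1_fluidLevel_le ht hY hY' hd x y))
  rw [outflow, outflow, abs_le]
  constructor <;> linarith

end TwoInflows

lemma abs_outflow_le {Y : Species → ℝ → ℝ} (ht : 0 ≤ t) (hY : ∀ a, ∀ s ∈ Icc 0 t, 0 ≤ Y a s)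
    {x : State} (hx : x ∈ orthant) (a : Species) : |outflow Y x t a| ≤ 10 * t := by
  have solo : ∀ (γ : ℝ) (a : Species), 0 ≤ γ → x a + Y a t - nodeLevel γ (x a) (Y a) t
      ∈ Icc 0 (γ * t) := fun γ a hγ => nodeLevel_deficit_mem ht hγ (hx a) (hY a)
  have node : ∀ h l : Species, 5 * x h + x l + (5 * Y h t + Y l t) - nodeWork Y x h l t
      ∈ Icc 0 (10 * t) := fun h l => nodeLevel_deficit_mem (x₀ := 5 * x h + x l)
    (Y := fun s => 5 * Y h s + Y l s) ht (by norm_num) (by linarith [hx h, hx l])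
    fun s hs => by linarith [hY h s hs, hY l s hs]
  have hO : outflow Y x t O ∈ _ := solo 3 O (by norm_num)
  have hAB : outflow Y x t AB ∈ _ := solo 2 AB (by norm_num)
  have hBA : outflow Y x t BA ∈ _ := solo 2 BA (by norm_num)
  have hA := node BA A
  have hB := node AB B
  simp only [mem_Icc, outflow] at hO hA hB hAB hBA
  rw [outflow, abs_le]
  cases a with
  | O | AB | BA => constructor <;> linarith
  | A => rw [fluidLevel_A]; constructor <;> linarith
  | B => rw [fluidLevel_B]; constructor <;> linarith

end Stability

/-! ### The generator on the lattice -/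

/-- The unit vector of `ℤ⁵` in the direction `a`. -/
abbrev unit (a : Species) : Config := Pi.single a 1

lemma rate_nonneg (a : Species) : 0 ≤ rate a := by cases a <;> norm_num [rate]

lemma rate_le (a : Species) : rate a ≤ 10 := by cases a <;> norm_num [rate]

lemma exitRate_nonneg (a : Species) (x : Config) : 0 ≤ exitRate a x := by
  unfold exitRate
  split_ifs
  exacts [rate_nonneg a, le_rfl]

lemma exitRate_le (a : Species) (x : Config) : exitRate a x ≤ rate a := by
  unfold exitRate
  split_ifs
  exacts [le_rfl, rate_nonneg a]

lemma sum_exitRate_le (x : Config) : ∑ a, exitRate a x ≤ 27 :=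
  (Finset.sum_le_sum fun a _ => exitRate_le a x).trans (by rw [sum_species]; norm_num [rate])

lemma pos_of_mem_busy {a : Species} {x : Config} (h : x ∈ busy a) : 0 < x a := by
  cases a
  exacts [h, h.1, h.1, h, h]

lemma exitRate_eq_zero {a : Species} {x : Config} (h : x a = 0) : exitRate a x = 0 :=
  if_neg fun hx => (pos_of_mem_busy hx).ne' h

lemma sub_unit_add_unit {a : Species} {x : Config} (h : 0 < x a) : x - unit a + unit a = x := by
  refine tsub_add_cancel_of_le fun c => ?_
  rcases eq_or_ne c a with rfl | hc
  · simpa using Nat.succ_le_of_lt h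
  · simp [hc]

lemma hasSum_comp_add_unit_iff {a : Species} {f : Config → ℝ} {s : ℝ}
    (hf : ∀ x : Config, x a = 0 → f x = 0) :
    HasSum (fun x => f (x + unit a)) s ↔ HasSum f s := by
  refine (add_left_injective (unit a)).hasSum_iff fun x hx => hf x ?_
  by_contra h
  exact hx ⟨x - unit a, sub_unit_add_unit (Nat.pos_of_ne_zero h)⟩

/-- Arrival rates with the a priori bound `27 = ∑ rate a` on their sum. -/
structure IsRate (β : Species → ℝ) : Prop where
  nonneg : ∀ a, 0 ≤ β a
  sum_le : ∑ a, β a ≤ 27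

lemma IsRate.le {β : Species → ℝ} (hβ : IsRate β) (a : Species) : β a ≤ 27 :=
  (Finset.single_le_sum (fun c _ => hβ.nonneg c) (Finset.mem_univ a)).trans hβ.sum_le

/-- The forward operator with the arrival rates `β`, shifted by `54 = 27 + 27`, a bound for the
total jump rate, which makes it positive. -/
def inflowOp (β : Species → ℝ) (q : Config → ℝ) (x : Config) : ℝ :=
  q x * (54 - ∑ a, β a - ∑ a, exitRate a x)
    + ∑ a, (if 0 < x a then q (x - unit a) * β a else 0)
    + ∑ a, q (x + unit a) * exitRate a (x + unit a)

/-- The operator on test functions which is adjoint to `inflowOp`. -/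
def adjOp (β : Species → ℝ) (F : Config → ℝ) (x : Config) : ℝ :=
  F x * (54 - ∑ a, β a - ∑ a, exitRate a x) + ∑ a, β a * F (x + unit a)
    + ∑ a, exitRate a x * F (x - unit a)

lemma forwardRHS_eq (p : Measure Config) (x : Config) :
    forwardRHS p x = inflowOp (arrivalRate p) (fun y => p.real {y}) x - 54 * p.real {x} := by
  simp only [forwardRHS, inflowOp]
  ring

lemma summable_mul_exitRate {f : Config → ℝ} (hf : Summable f) (a : Species) :
    Summable fun x => f x * exitRate a x := by
  refine Summable.of_norm_bounded (hf.abs.mul_right 10) fun x => ?_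
  rw [Real.norm_eq_abs, abs_mul, abs_of_nonneg (exitRate_nonneg a x)]
  exact mul_le_mul_of_nonneg_left ((exitRate_le a x).trans (rate_le a)) (abs_nonneg _)

lemma hasSum_arrival_mul (a : Species) (c : ℝ) {q F : Config → ℝ}
    (h : Summable fun x => q x * F (x + unit a)) :
    HasSum (fun x => (if 0 < x a then q (x - unit a) * c else 0) * F x)
      (∑' x, q x * (c * F (x + unit a))) := by
  rw [← hasSum_comp_add_unit_iff (a := a) fun x hx => by simp [hx]]
  refine ((h.mul_left c).congr fun x => by ring).hasSum.congr_fun fun x => ?_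
  simp [mul_assoc]

lemma hasSum_departure_mul (a : Species) {q F : Config → ℝ}
    (h : Summable fun x => q x * F (x - unit a)) :
    HasSum (fun x => q (x + unit a) * exitRate a (x + unit a) * F x)
      (∑' x, q x * (exitRate a x * F (x - unit a))) := by
  have hsum : HasSum (fun x => q x * (exitRate a x * F (x - unit a))) _ :=
    ((summable_mul_exitRate h a).congr fun x => by ring).hasSum
  rw [← hasSum_comp_add_unit_iff (a := a) fun x hx => by simp [exitRate_eq_zero hx]] at hsum
  refine hsum.congr_fun fun x => ?_
  simp [mul_assoc]

lemma hasSum_inflowOp_mul (β : Species → ℝ) {q F : Config → ℝ}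
    (h : Summable fun x => q x * F x) (hadd : ∀ a, Summable fun x => q x * F (x + unit a))
    (hsub : ∀ a, Summable fun x => q x * F (x - unit a)) :
    HasSum (fun x => inflowOp β q x * F x) (∑' x, q x * adjOp β F x) := by
  have hstay : Summable fun x => q x * (F x * (54 - ∑ a, β a - ∑ a, exitRate a x)) := by
    refine ((h.mul_right (54 - ∑ a, β a)).sub
      (summable_sum (s := Finset.univ) fun a _ => summable_mul_exitRate h a)).congr fun x => ?_
    rw [← Finset.mul_sum]
    ring
  have harr : ∀ a, Summable fun x => q x * (β a * F (x + unit a)) := fun a =>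
    ((hadd a).mul_left (β a)).congr fun x => by ring
  have hdep : ∀ a, Summable fun x => q x * (exitRate a x * F (x - unit a)) := fun a =>
    (summable_mul_exitRate (hsub a) a).congr fun x => by ring
  have hadj := (hstay.hasSum.add (hasSum_sum (s := Finset.univ) fun a _ => (harr a).hasSum)).add
    (hasSum_sum (s := Finset.univ) fun a _ => (hdep a).hasSum)
  have hflow := (hstay.hasSum.add (hasSum_sum (s := Finset.univ) fun a _ =>
      hasSum_arrival_mul a (β a) (hadd a))).add
    (hasSum_sum (s := Finset.univ) fun a _ => hasSum_departure_mul a (hsub a))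
  rw [(hadj.congr_fun fun x => by simp only [adjOp, mul_add, Finset.mul_sum] :
    HasSum (fun x => q x * adjOp β F x) _).tsum_eq]
  refine hflow.congr_fun fun x => ?_
  simp only [inflowOp, add_mul, Finset.sum_mul]
  ring

lemma adjOp_one (β : Species → ℝ) (x : Config) : adjOp β (fun _ => 1) x = 54 := by
  simp only [adjOp, one_mul, mul_one]
  ring

lemma IsRate.shift_nonneg {β : Species → ℝ} (hβ : IsRate β) (x : Config) :
    0 ≤ 54 - ∑ a, β a - ∑ a, exitRate a x := by
  linarith [hβ.sum_le, sum_exitRate_le x]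

lemma adjOp_nonneg {β : Species → ℝ} (hβ : IsRate β) {F : Config → ℝ} (h : ∀ x, 0 ≤ F x)
    (x : Config) : 0 ≤ adjOp β F x :=
  add_nonneg (add_nonneg (mul_nonneg (h x) (hβ.shift_nonneg x))
    (Finset.sum_nonneg fun a _ => mul_nonneg (hβ.nonneg a) (h _)))
    (Finset.sum_nonneg fun a _ => mul_nonneg (exitRate_nonneg a x) (h _))

lemma inflowOp_mono {β : Species → ℝ} (hβ : IsRate β) {q q' : Config → ℝ} (h : ∀ x, q x ≤ q' x)
    (x : Config) : inflowOp β q x ≤ inflowOp β q' x := by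
  unfold inflowOp
  refine add_le_add (add_le_add (mul_le_mul_of_nonneg_right (h x) (hβ.shift_nonneg x))
    (Finset.sum_le_sum fun a _ => ?_))
    (Finset.sum_le_sum fun a _ => mul_le_mul_of_nonneg_right (h _) (exitRate_nonneg a _))
  split_ifs
  exacts [mul_le_mul_of_nonneg_right (h _) (hβ.nonneg a), le_rfl]

@[simp] lemma inflowOp_zero (β : Species → ℝ) (x : Config) : inflowOp β (fun _ => 0) x = 0 := by
  simp [inflowOp]

lemma inflowOp_nonneg {β : Species → ℝ} (hβ : IsRate β) {q : Config → ℝ} (h : ∀ x, 0 ≤ q x)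
    (x : Config) : 0 ≤ inflowOp β q x := by
  simpa using inflowOp_mono hβ h x

lemma inflowOp_smul (β : Species → ℝ) (c : ℝ) (q : Config → ℝ) (x : Config) :
    inflowOp β (fun y => c * q y) x = c * inflowOp β q x := by
  simp only [inflowOp, mul_add, Finset.mul_sum, mul_ite, mul_zero, mul_assoc]

lemma inflowOp_add (β : Species → ℝ) (q q' : Config → ℝ) (x : Config) :
    inflowOp β (fun y => q y + q' y) x = inflowOp β q x + inflowOp β q' x := by
  simp only [inflowOp, add_mul, ite_add_zero, Finset.sum_add_distrib]
  ring

lemma inflowOp_sum {ι : Type*} (β : Species → ℝ) (J : Finset ι) (q : ι → Config → ℝ) (x : Config) :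
    inflowOp β (fun y => ∑ i ∈ J, q i y) x = ∑ i ∈ J, inflowOp β (q i) x := by
  classical
  induction J using Finset.induction_on with
  | empty => simp
  | insert i J hi ih => simp only [Finset.sum_insert hi, ← ih, inflowOp_add]

lemma continuous_inflowOp {b : Species → ℝ → ℝ} (hb : ∀ a, Continuous (b a))
    {q : ℝ → Config → ℝ} (hq : ∀ x, Continuous fun t => q t x) (x : Config) :
    Continuous fun t => inflowOp (fun a => b a t) (q t) x := by
  unfold inflowOp
  refine (((hq x).mul (by fun_prop)).add (continuous_finsetSum _ fun a _ => ?_)).add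
    (continuous_finsetSum _ fun a _ => (hq _).mul continuous_const)
  split_ifs
  exacts [(hq _).mul (hb a), continuous_const]

/-- The box in which a queue started at `x₀` stays up to its `n`-th jump. -/
def reach (x₀ : Config) (n : ℕ) : Finset Config := Finset.Iic fun a => x₀ a + n

lemma mem_reach {x₀ x : Config} {n : ℕ} : x ∈ reach x₀ n ↔ ∀ a, x a ≤ x₀ a + n := Finset.mem_Iic

lemma reach_mono (x₀ : Config) {n m : ℕ} (h : n ≤ m) : reach x₀ n ⊆ reach x₀ m := fun _ hx =>
  mem_reach.2 fun a => (mem_reach.1 hx a).trans (Nat.add_le_add_left h _)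

lemma self_mem_reach (x₀ : Config) (n : ℕ) : x₀ ∈ reach x₀ n :=
  mem_reach.2 fun _ => Nat.le_add_right _ _

lemma inflowOp_eq_zero (β : Species → ℝ) {q : Config → ℝ} {x₀ : Config} {n : ℕ}
    (hq : ∀ x ∉ reach x₀ n, q x = 0) {x : Config} (hx : x ∉ reach x₀ (n + 1)) :
    inflowOp β q x = 0 := by
  have hunit : ∀ a c : Species, unit a c ≤ 1 := fun a c => by
    rcases eq_or_ne c a with rfl | hc
    · simp
    · simp [hc]
  have hstay : q x = 0 := hq x fun h => hx (reach_mono x₀ n.le_succ h)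
  have harr : ∀ a, q (x - unit a) = 0 := fun a => hq _ fun h => hx <| mem_reach.2 fun c => by
    have hc : x c - unit a c ≤ x₀ c + n := mem_reach.1 h c
    have := hunit a c
    omega
  have hdep : ∀ a, q (x + unit a) = 0 := fun a => hq _ fun h => hx <| mem_reach.2 fun c => by
    have hc : x c + unit a c ≤ x₀ c + n := mem_reach.1 h c
    omega
  simp [inflowOp, hstay, harr, hdep]

/-! ### Picard iterates for the transition probabilities -/

/-- Picard iterates for the forward equation started from the point `x₀`, with the arrival rates
`b`; they increase to `exp (54 t)` times the transition probabilities. -/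
def picard (b : Species → ℝ → ℝ) (x₀ : Config) : ℕ → ℝ → Config → ℝ
  | 0, _, _ => 0
  | n + 1, t, x => (if x = x₀ then 1 else 0)
      + ∫ s in (0 : ℝ)..t, inflowOp (fun a => b a s) (picard b x₀ n s) x

lemma integral_mul_pow_div_factorial (c t : ℝ) (k : ℕ) :
    ∫ s in (0 : ℝ)..t, c * (c * s) ^ k / k.factorial = (c * t) ^ (k + 1) / (k + 1).factorial := by
  have hs : ∀ s : ℝ, c * (c * s) ^ k / k.factorial = c ^ (k + 1) / k.factorial * s ^ k :=
    fun s => by ring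
  simp only [hs, intervalIntegral.integral_const_mul, integral_pow, Nat.factorial_succ]
  field_simp
  push_cast
  ring

/-- The probability that a Poisson variable with mean `54 t` is smaller than `n`: the total mass of
the `n`-th Picard iterate, once the factor `e ^ (54 t)` is taken off. -/
def poissonMass (n : ℕ) (t : ℝ) : ℝ :=
  Real.exp (-(54 * t)) * ∑ k ∈ Finset.range n, (54 * t) ^ k / k.factorial

lemma poissonMass_nonneg (n : ℕ) {t : ℝ} (ht : 0 ≤ t) : 0 ≤ poissonMass n t :=
  mul_nonneg (Real.exp_pos _).le (Finset.sum_nonneg fun k _ => by positivity)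

lemma poissonMass_le_one (n : ℕ) {t : ℝ} (ht : 0 ≤ t) : poissonMass n t ≤ 1 := by
  rw [poissonMass, Real.exp_neg]
  exact inv_mul_le_one_of_le₀ (Real.sum_le_exp_of_nonneg (by positivity) n) (Real.exp_pos _).le

lemma tendsto_poissonMass (t : ℝ) : Tendsto (fun n => poissonMass n t) atTop (𝓝 1) := by
  have h := (NormedSpace.expSeries_div_hasSum_exp (54 * t)).tendsto_sum_nat
  rw [← Real.exp_eq_exp_ℝ] at h
  simpa [poissonMass, ← Real.exp_add] using h.const_mul (Real.exp (-(54 * t)))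

section Picard

variable {b : Species → ℝ → ℝ} {x₀ : Config}

lemma continuous_picard (hb : ∀ a, Continuous (b a)) (n : ℕ) (x : Config) :
    Continuous fun t => picard b x₀ n t x := by
  induction n generalizing x with
  | zero => exact continuous_const
  | succ n ih =>
    refine continuous_const.add (intervalIntegral.continuous_primitive (fun s t => ?_) 0)
    exact (continuous_inflowOp hb ih x).intervalIntegrable s t

lemma continuous_inflowOp_picard (hb : ∀ a, Continuous (b a)) (n : ℕ) (x : Config) :
    Continuous fun t => inflowOp (fun a => b a t) (picard b x₀ n t) x :=
  continuous_inflowOp hb (continuous_picard hb n) x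

lemma hasDerivAt_picard (hb : ∀ a, Continuous (b a)) (n : ℕ) (x : Config) (t : ℝ) :
    HasDerivAt (fun t => picard b x₀ (n + 1) t x)
      (inflowOp (fun a => b a t) (picard b x₀ n t) x) t := by
  have hc := continuous_inflowOp_picard (x₀ := x₀) hb n x
  exact (intervalIntegral.integral_hasDerivAt_right (hc.intervalIntegrable 0 t)
    (hc.stronglyMeasurableAtFilter _ _) hc.continuousAt).const_add _

lemma picard_le_succ (hb : ∀ a, Continuous (b a)) (hr : ∀ t, IsRate fun a => b a t) (n : ℕ)
    {t : ℝ} (ht : 0 ≤ t) (x : Config) : picard b x₀ n t x ≤ picard b x₀ (n + 1) t x := by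
  induction n generalizing t x with
  | zero =>
    have h0 : ∀ s, inflowOp (fun a => b a s) (picard b x₀ 0 s) x = 0 := fun s =>
      inflowOp_zero _ x
    change 0 ≤ (if x = x₀ then (1 : ℝ) else 0) + _
    simp only [h0, intervalIntegral.integral_zero, add_zero]
    split_ifs <;> norm_num
  | succ n ih =>
    exact add_le_add_right (intervalIntegral.integral_mono_on ht
      ((continuous_inflowOp_picard hb _ x).intervalIntegrable _ _)
      ((continuous_inflowOp_picard hb _ x).intervalIntegrable _ _)
      fun s hs => inflowOp_mono (hr s) (fun y => ih hs.1 y) x) _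

lemma picard_nonneg (hb : ∀ a, Continuous (b a)) (hr : ∀ t, IsRate fun a => b a t) (n : ℕ)
    {t : ℝ} (ht : 0 ≤ t) (x : Config) : 0 ≤ picard b x₀ n t x := by
  induction n with
  | zero => exact le_rfl
  | succ n ih => exact ih.trans (picard_le_succ hb hr n ht x)

lemma picard_eq_zero (n : ℕ) (t : ℝ) {x : Config} (hx : x ∉ reach x₀ n) :
    picard b x₀ n t x = 0 := by
  induction n generalizing t x with
  | zero => rfl
  | succ n ih =>
    have h0 : ∀ s, inflowOp (fun a => b a s) (picard b x₀ n s) x = 0 := fun s =>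
      inflowOp_eq_zero _ (fun _ => ih s) hx
    have hne : x ≠ x₀ := by
      rintro rfl
      exact hx (self_mem_reach _ _)
    simp [picard, h0, hne]

lemma tsum_picard_mul {n m : ℕ} (hnm : n ≤ m) (t : ℝ) (F : Config → ℝ) :
    ∑' x, picard b x₀ n t x * F x = ∑ x ∈ reach x₀ m, picard b x₀ n t x * F x :=
  tsum_eq_sum fun x hx => by
    rw [picard_eq_zero n t fun h => hx (reach_mono x₀ hnm h), zero_mul]

lemma summable_picard_mul (n : ℕ) (t : ℝ) (F : Config → ℝ) :
    Summable fun x => picard b x₀ n t x * F x :=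
  summable_of_ne_finset_zero fun x (hx : x ∉ reach x₀ n) => by
    rw [picard_eq_zero n t hx, zero_mul]

lemma sum_inflowOp_picard (β : Species → ℝ) (n : ℕ) (t : ℝ) (F : Config → ℝ) :
    ∑ x ∈ reach x₀ (n + 1), inflowOp β (picard b x₀ n t) x * F x
      = ∑' x, picard b x₀ n t x * adjOp β F x := by
  rw [← (hasSum_inflowOp_mul β (summable_picard_mul n t F) (fun a => summable_picard_mul n t _)
    fun a => summable_picard_mul n t _).tsum_eq]
  refine (tsum_eq_sum fun x hx => ?_).symm
  rw [inflowOp_eq_zero β (fun x => picard_eq_zero n t) hx, zero_mul]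

lemma tsum_picard (hb : ∀ a, Continuous (b a)) (n : ℕ) (t : ℝ) :
    ∑' x, picard b x₀ n t x = ∑ k ∈ Finset.range n, (54 * t) ^ k / k.factorial := by
  induction n generalizing t with
  | zero => simp [picard]
  | succ n ih =>
    have hmass : ∀ s, ∑ x ∈ reach x₀ (n + 1), inflowOp (fun a => b a s) (picard b x₀ n s) x
        = ∑ k ∈ Finset.range n, 54 * (54 * s) ^ k / k.factorial := fun s =>
      calc _ = ∑' x, picard b x₀ n s x * 54 := by
            simpa only [adjOp_one, mul_one] using
              sum_inflowOp_picard (b := b) (x₀ := x₀) (fun a => b a s) n s fun _ => 1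
        _ = _ := by
            rw [tsum_mul_right, ih, Finset.sum_mul]
            exact Finset.sum_congr rfl fun k _ => by ring
    calc ∑' x, picard b x₀ (n + 1) t x = ∑ x ∈ reach x₀ (n + 1), picard b x₀ (n + 1) t x := by
          simpa only [mul_one] using tsum_picard_mul (b := b) (x₀ := x₀) le_rfl t fun _ => 1
      _ = 1 + ∫ s in (0 : ℝ)..t, ∑ x ∈ reach x₀ (n + 1),
            inflowOp (fun a => b a s) (picard b x₀ n s) x := by
          rw [intervalIntegral.integral_finsetSum fun x _ =>
            (continuous_inflowOp_picard hb n x).intervalIntegrable _ _]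
          simp only [picard, Finset.sum_add_distrib]
          rw [Finset.sum_ite_eq', if_pos (self_mem_reach _ _)]
      _ = 1 + ∑ k ∈ Finset.range n, (54 * t) ^ (k + 1) / (k + 1).factorial := by
          simp only [hmass]
          rw [intervalIntegral.integral_finsetSum fun k _ =>
            Continuous.intervalIntegrable (by fun_prop) _ _]
          simp only [integral_mul_pow_div_factorial]
      _ = _ := by simp [Finset.sum_range_succ', add_comm]

lemma exp_mul_tsum_picard (hb : ∀ a, Continuous (b a)) (n : ℕ) (t : ℝ) :
    Real.exp (-(54 * t)) * ∑' x, picard b x₀ n t x = poissonMass n t := by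
  rw [tsum_picard hb, poissonMass]

lemma exp_mul_sum_picard_le (hb : ∀ a, Continuous (b a)) (n : ℕ) {t : ℝ} (ht : 0 ≤ t) :
    Real.exp (-(54 * t)) * ∑ x ∈ reach x₀ n, picard b x₀ n t x ≤ 1 := by
  have hmass := tsum_picard_mul (b := b) (x₀ := x₀) (le_refl n) t fun _ => 1
  simp only [mul_one] at hmass
  rw [← hmass, exp_mul_tsum_picard hb]
  exact poissonMass_le_one n ht

end Picard

/-! ### Quadratic Lyapunov functions -/

/-- A weighted number of customers. -/
def load (w : Species → ℝ) (x : Config) : ℝ := ∑ a, w a * x a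

lemma load_nonneg {w : Species → ℝ} (hw : ∀ a, 0 ≤ w a) (x : Config) : 0 ≤ load w x :=
  Finset.sum_nonneg fun a _ => mul_nonneg (hw a) (Nat.cast_nonneg _)

lemma load_add_unit (w : Species → ℝ) (x : Config) (a : Species) :
    load w (x + unit a) = load w x + w a := by
  have hterm : ∀ c, w c * (((x + unit a) c : ℕ) : ℝ) = w c * x c + if c = a then w c else 0 := by
    intro c
    rcases eq_or_ne c a with rfl | hc
    · simp [mul_add]
    · simp [hc]
  simp only [load, hterm, Finset.sum_add_distrib, Finset.sum_ite_eq', Finset.mem_univ, if_true]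

lemma load_sub_unit (w : Species → ℝ) {x : Config} {a : Species} (h : 0 < x a) :
    load w (x - unit a) = load w x - w a := by
  have := load_add_unit w (x - unit a) a
  rw [sub_unit_add_unit h] at this
  linarith

/-- The weights `w` measure the work at a node which serves with the constant speed `γ` as long as
there is some work. -/
structure IsWork (w : Species → ℝ) (γ : ℝ) : Prop where
  nonneg : ∀ a, 0 ≤ w a
  le : ∀ a, w a ≤ 5
  speed_le : ∀ x, ∑ a, exitRate a x * w a ≤ γ
  speed_eq : ∀ x, load w x ≠ 0 → ∑ a, exitRate a x * w a = γ

namespace IsWork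

variable {w : Species → ℝ} {γ : ℝ}

lemma speed_nonneg (hw : IsWork w γ) : 0 ≤ γ :=
  (Finset.sum_nonneg fun a _ => mul_nonneg (exitRate_nonneg a 0) (hw.nonneg a)).trans
    (hw.speed_le 0)

lemma sum_mul_sq_le (hw : IsWork w γ) {c : Species → ℝ} (hc : ∀ a, 0 ≤ c a)
    (hsum : ∑ a, c a ≤ 27) : ∑ a, c a * w a ^ 2 ≤ 675 :=
  calc ∑ a, c a * w a ^ 2 ≤ ∑ a, c a * 5 ^ 2 := Finset.sum_le_sum fun a _ =>
        mul_le_mul_of_nonneg_left (pow_le_pow_left₀ (hw.nonneg a) (hw.le a) 2) (hc a)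
    _ ≤ 675 := by rw [← Finset.sum_mul]; linarith

/-- The work is not served at full speed only if it vanishes, and then it lies below the level
`X`. -/
lemma load_sub_mul_idle_nonpos (hw : IsWork w γ) {X : ℝ} (hX : 0 ≤ X) (x : Config) :
    (load w x - X) * (γ - ∑ a, exitRate a x * w a) ≤ 0 := by
  rcases eq_or_ne (load w x) 0 with h | h
  · exact mul_nonpos_of_nonpos_of_nonneg (by linarith) (sub_nonneg.2 (hw.speed_le x))
  · rw [hw.speed_eq x h, sub_self, mul_zero]

/-- Each jump changes the load by at most `5` and the jumps have total rate at most `54`, whence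
the constant `1350 = 54 * 5 ^ 2`. -/
lemma adjOp_sq_le (hw : IsWork w γ) {β : Species → ℝ} (hβ : IsRate β) {X : ℝ} (hX : 0 ≤ X)
    (x : Config) :
    adjOp β (fun y => (load w y - X) ^ 2) x
      ≤ 54 * (load w x - X) ^ 2 + 2 * (load w x - X) * (∑ a, w a * β a - γ) + 1350 := by
  have hdep : ∀ a, exitRate a x * (load w (x - unit a) - X) ^ 2
      = exitRate a x * (load w x - X) ^ 2 - 2 * (load w x - X) * (exitRate a x * w a)
        + exitRate a x * w a ^ 2 := by
    intro a
    rcases (x a).eq_zero_or_pos with h | h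
    · simp [exitRate_eq_zero h]
    · rw [load_sub_unit w h]; ring
  have harr : ∀ a, β a * (load w (x + unit a) - X) ^ 2
      = β a * (load w x - X) ^ 2 + 2 * (load w x - X) * (w a * β a) + β a * w a ^ 2 := by
    intro a
    rw [load_add_unit]; ring
  have hexpand : adjOp β (fun y => (load w y - X) ^ 2) x
      = 54 * (load w x - X) ^ 2
        + 2 * (load w x - X) * (∑ a, w a * β a - ∑ a, exitRate a x * w a)
        + (∑ a, β a * w a ^ 2 + ∑ a, exitRate a x * w a ^ 2) := by
    simp only [adjOp, hdep, harr, Finset.sum_add_distrib, Finset.sum_sub_distrib,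
      ← Finset.mul_sum, ← Finset.sum_mul]
    ring
  rw [hexpand]
  linarith [hw.sum_mul_sq_le hβ.nonneg hβ.sum_le, hw.load_sub_mul_idle_nonpos hX x,
    hw.sum_mul_sq_le (fun a => exitRate_nonneg a x) (sum_exitRate_le x)]

end IsWork

/-- The net inflow generated by the arrival rates `b`. -/
def inflow (b : Species → ℝ → ℝ) (a : Species) (t : ℝ) : ℝ := ∫ s in (0 : ℝ)..t, b a s

/-- The virtual level of the work `w` at a node of speed `γ`, for the inflows `inflow b` and the
initial configuration `x₀`. -/
def virtualWork (b : Species → ℝ → ℝ) (w : Species → ℝ) (γ : ℝ) (x₀ : Config) : ℝ → ℝ :=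
  virtualLevel γ (load w x₀) fun t => ∑ a, w a * inflow b a t

/-- The fluid level corresponding to `virtualWork`. -/
def workLevel (b : Species → ℝ → ℝ) (w : Species → ℝ) (γ : ℝ) (x₀ : Config) : ℝ → ℝ :=
  reflected (virtualWork b w γ x₀)

lemma eventually_slope_lt_of_le {f g : ℝ → ℝ} {g' t r : ℝ} (hg : HasDerivAt g g' t)
    (hfg : ∀ z, t < z → f z ≤ g z) (heq : f t = g t) (hr : g' < r) :
    ∀ᶠ z in 𝓝[>] t, slope f t z < r := by
  have hslope := ((hasDerivWithinAt_iff_tendsto_slope' (by simp)).1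
    (hg.hasDerivWithinAt (s := Ioi t))).eventually_lt_const hr
  filter_upwards [hslope, self_mem_nhdsWithin] with z hz (htz : t < z)
  refine lt_of_le_of_lt ?_ hz
  rw [slope_def_field, slope_def_field, heq]
  exact div_le_div_of_nonneg_right (sub_le_sub_right (hfg z htz) _) (sub_nonneg.2 htz.le)

section Lyapunov

variable {b : Species → ℝ → ℝ} {x₀ : Config} {w : Species → ℝ} {γ : ℝ}

lemma hasDerivAt_inflow (hb : ∀ a, Continuous (b a)) (a : Species) (t : ℝ) :
    HasDerivAt (inflow b a) (b a t) t :=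
  intervalIntegral.integral_hasDerivAt_right ((hb a).intervalIntegrable 0 t)
    ((hb a).stronglyMeasurableAtFilter _ _) (hb a).continuousAt

lemma monotone_inflow (hb : ∀ a, Continuous (b a)) (hr : ∀ t, IsRate fun a => b a t)
    (a : Species) : Monotone (inflow b a) :=
  monotone_of_hasDerivAt_nonneg (hasDerivAt_inflow hb a) fun t => (hr t).nonneg a

lemma inflow_zero (b : Species → ℝ → ℝ) (a : Species) : inflow b a 0 = 0 :=
  intervalIntegral.integral_same

lemma inflow_nonneg (hb : ∀ a, Continuous (b a)) (hr : ∀ t, IsRate fun a => b a t) (a : Species)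
    {t : ℝ} (ht : 0 ≤ t) : 0 ≤ inflow b a t :=
  (inflow_zero b a).symm.trans_le (monotone_inflow hb hr a ht)

lemma lipschitzWith_inflow (hb : ∀ a, Continuous (b a)) (hr : ∀ t, IsRate fun a => b a t)
    (a : Species) : LipschitzWith 27 (inflow b a) := by
  refine lipschitzWith_of_nnnorm_deriv_le (fun t => (hasDerivAt_inflow hb a t).differentiableAt)
    fun t => ?_
  rw [(hasDerivAt_inflow hb a t).deriv, ← NNReal.coe_le_coe, coe_nnnorm, Real.norm_eq_abs,
    abs_of_nonneg ((hr t).nonneg a)]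
  exact (hr t).le a

lemma hasDerivAt_virtualWork (hb : ∀ a, Continuous (b a)) (t : ℝ) :
    HasDerivAt (virtualWork b w γ x₀) (∑ a, w a * b a t - γ) t := by
  have hsum : HasDerivAt (fun t => ∑ a, w a * inflow b a t) (∑ a, w a * b a t) t :=
    HasDerivAt.fun_sum fun a _ => (hasDerivAt_inflow hb a t).const_mul (w a)
  exact ((hsum.const_add (load w x₀)).fun_sub ((hasDerivAt_id t).const_mul γ)).congr_deriv
    (by rw [mul_one])

lemma exists_lipschitzWith_virtualWork (hw : IsWork w γ) (hb : ∀ a, Continuous (b a))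
    (hr : ∀ t, IsRate fun a => b a t) (x₀ : Config) :
    ∃ K : ℝ≥0, LipschitzWith K (virtualWork b w γ x₀) := by
  refine ⟨(135 + γ).toNNReal, lipschitzWith_of_nnnorm_deriv_le
    (fun t => (hasDerivAt_virtualWork hb t).differentiableAt) fun t => ?_⟩
  have hpos : 0 ≤ ∑ a, w a * b a t :=
    Finset.sum_nonneg fun a _ => mul_nonneg (hw.nonneg a) ((hr t).nonneg a)
  have hle : ∑ a, w a * b a t ≤ 135 :=
    calc ∑ a, w a * b a t ≤ ∑ a, 5 * b a t := Finset.sum_le_sum fun a _ =>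
          mul_le_mul_of_nonneg_right (hw.le a) ((hr t).nonneg a)
      _ ≤ 135 := by rw [← Finset.mul_sum]; linarith [(hr t).sum_le]
  rw [(hasDerivAt_virtualWork hb t).deriv, ← NNReal.coe_le_coe, coe_nnnorm,
    Real.coe_toNNReal _ (by linarith [hw.speed_nonneg])]
  exact abs_le.2 ⟨by linarith [hw.speed_nonneg], by linarith [hw.speed_nonneg]⟩

lemma workLevel_nonneg (hw : IsWork w γ) (hb : ∀ a, Continuous (b a))
    (hr : ∀ t, IsRate fun a => b a t) {t : ℝ} (ht : 0 ≤ t) : 0 ≤ workLevel b w γ x₀ t := by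
  obtain ⟨K, hK⟩ := exists_lipschitzWith_virtualWork hw hb hr x₀
  exact reflected_nonneg (bddBelow_image_of_lipschitzOn hK.lipschitzOnWith) ht

lemma workLevel_zero (hw : IsWork w γ) : workLevel b w γ x₀ 0 = load w x₀ := by
  have h : virtualWork b w γ x₀ 0 = load w x₀ := by
    simp [virtualWork, virtualLevel, inflow_zero]
  rw [workLevel, reflected_zero (h ▸ load_nonneg hw.nonneg x₀), h]

lemma sum_inflowOp_picard_le (hb : ∀ a, Continuous (b a)) (hr : ∀ t, IsRate fun a => b a t)
    (n : ℕ) {t : ℝ} (ht : 0 ≤ t) {F G : Config → ℝ} (hF : ∀ x, 0 ≤ F x)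
    (hFG : ∀ x, adjOp (fun a => b a t) F x ≤ G x) :
    ∑ x ∈ reach x₀ (n + 1), inflowOp (fun a => b a t) (picard b x₀ n t) x * F x
      ≤ ∑ x ∈ reach x₀ (n + 1), picard b x₀ (n + 1) t x * G x := by
  rw [sum_inflowOp_picard, tsum_picard_mul n.le_succ]
  exact Finset.sum_le_sum fun x _ =>
    mul_le_mul (picard_le_succ hb hr n ht x) (hFG x) (adjOp_nonneg (hr t) hF x)
      (picard_nonneg hb hr _ ht x)

lemma lyapunov_drift_le (hw : IsWork w γ) (hb : ∀ a, Continuous (b a))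
    (hr : ∀ t, IsRate fun a => b a t) (n : ℕ) {t X : ℝ} (ht : 0 ≤ t) (hX : 0 ≤ X) :
    Real.exp (-(54 * t)) * (-54) * ∑ x ∈ reach x₀ (n + 1),
        picard b x₀ (n + 1) t x * (load w x - X) ^ 2
      + Real.exp (-(54 * t)) * ∑ x ∈ reach x₀ (n + 1),
        (inflowOp (fun a => b a t) (picard b x₀ n t) x * (load w x - X) ^ 2
          + picard b x₀ (n + 1) t x * -(2 * (load w x - X) * (∑ a, w a * b a t - γ))) ≤ 1350 := by
  set S := reach x₀ (n + 1)
  set P := picard b x₀ (n + 1) t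
  have hgen := sum_inflowOp_picard_le (x₀ := x₀) hb hr n ht (fun x => sq_nonneg (load w x - X))
    fun x => hw.adjOp_sq_le (hr t) hX x
  have hmass : Real.exp (-(54 * t)) * ∑ x ∈ S, P x ≤ 1 :=
    exp_mul_sum_picard_le hb (n + 1) ht
  have hsum : ∑ x ∈ S, P x * (54 * (load w x - X) ^ 2
        + 2 * (load w x - X) * (∑ a, w a * b a t - γ) + 1350)
      = 54 * ∑ x ∈ S, P x * (load w x - X) ^ 2
        - ∑ x ∈ S, P x * -(2 * (load w x - X) * (∑ a, w a * b a t - γ))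
        + 1350 * ∑ x ∈ S, P x := by
    simp only [Finset.mul_sum, ← Finset.sum_sub_distrib, ← Finset.sum_add_distrib]
    exact Finset.sum_congr rfl fun x _ => by ring
  rw [Finset.sum_add_distrib]
  rw [hsum] at hgen
  linear_combination Real.exp (-(54 * t)) * hgen + 1350 * hmass

lemma lyapunov_slope_lt (hw : IsWork w γ) (hb : ∀ a, Continuous (b a))
    (hr : ∀ t, IsRate fun a => b a t) (n : ℕ) {t r : ℝ} (ht : 0 ≤ t) (h1350 : 1350 < r) :
    ∀ᶠ z in 𝓝[>] t, slope (fun z => Real.exp (-(54 * z)) *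
      ∑ x ∈ reach x₀ (n + 1), picard b x₀ (n + 1) z x *
        (load w x - workLevel b w γ x₀ z) ^ 2) t z < r := by
  obtain ⟨K, hK⟩ := exists_lipschitzWith_virtualWork hw hb hr x₀
  set V := virtualWork b w γ x₀
  set X := workLevel b w γ x₀ t with hX
  let G : Config → ℝ → ℝ := fun x z => (load w x - X) ^ 2 - 2 * (load w x - X) * (V z - V t)
    + 6 * K ^ 2 * (z - t) ^ 2
  have hGt : ∀ x, G x t = (load w x - X) ^ 2 := fun x => by simp [G]
  have hG : ∀ x, HasDerivAt (G x) (-(2 * (load w x - X) * (∑ a, w a * b a t - γ))) t := fun x =>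
    (((((hasDerivAt_virtualWork hb t).sub_const (V t)).const_mul (2 * (load w x - X))).const_sub
      ((load w x - X) ^ 2)).add ((((hasDerivAt_id t).sub_const t).pow 2).const_mul
        (6 * (K : ℝ) ^ 2))).congr_deriv (by simp)
  have hexp : HasDerivAt (fun z : ℝ => Real.exp (-(54 * z))) (Real.exp (-(54 * t)) * (-54)) t :=
    ((hasDerivAt_id t).const_mul 54).fun_neg.exp.congr_deriv (by simp)
  refine eventually_slope_lt_of_le (hexp.fun_mul (HasDerivAt.fun_sum (u := reach x₀ (n + 1))
    fun x _ => (hasDerivAt_picard (x₀ := x₀) hb n x t).fun_mul (hG x))) (fun z htz => ?_) ?_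
    (lt_of_le_of_lt ?_ h1350)
  · gcongr with x _
    · exact picard_nonneg hb hr (n + 1) (ht.trans htz.le) x
    · exact sq_sub_reflected_le hK.lipschitzOnWith ht htz.le (load_nonneg hw.nonneg x)
  · simp only [hGt, hX]
  · simp only [hGt]
    exact lyapunov_drift_le hw hb hr n ht (workLevel_nonneg hw hb hr ht)

lemma lyapunov_le (hw : IsWork w γ) (hb : ∀ a, Continuous (b a))
    (hr : ∀ t, IsRate fun a => b a t) (n : ℕ) {t : ℝ} (ht : 0 ≤ t) :
    Real.exp (-(54 * t)) * ∑' x, picard b x₀ n t x * (load w x - workLevel b w γ x₀ t) ^ 2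
      ≤ 1350 * t := by
  rcases n with _ | n
  · simp [picard, ht]
  rw [tsum_picard_mul le_rfl]
  obtain ⟨K, hK⟩ := exists_lipschitzWith_virtualWork hw hb hr x₀
  have hlevel : ContinuousOn (workLevel b w γ x₀) (Icc 0 t) :=
    continuousOn_reflected hK.lipschitzOnWith
  refine image_le_of_liminf_slope_right_le_deriv_boundary (a := 0) (b := t)
    (B := fun t => 1350 * t) (B' := fun _ => 1350) ?_ ?_ (by fun_prop) (fun s _ => ?_)
    (fun s hs r hr' => (lyapunov_slope_lt hw hb hr n hs.1 hr').frequently) ⟨ht, le_rfl⟩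
  · refine ContinuousOn.mul (by fun_prop) (continuousOn_finsetSum _ fun x _ => ?_)
    exact (continuous_picard hb _ x).continuousOn.mul ((continuousOn_const.sub hlevel).pow 2)
  · simp [picard, workLevel_zero hw, ite_mul]
  · simpa using ((hasDerivAt_id s).const_mul 1350).hasDerivWithinAt

end Lyapunov

/-! ### Trajectories of the Markov process -/

section Countable

variable {α : Type*} [Countable α] [MeasurableSpace α] [DiscreteMeasurableSpace α]

lemma hasSum_measureReal_singleton_mul (μ : Measure α) [IsFiniteMeasure μ] {g : α → ℝ} {M : ℝ}
    (hM : ∀ x, |g x| ≤ M) : HasSum (fun x => μ.real {x} * g x) (∫ x, g x ∂μ) := by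
  have hsingle : Summable fun x => μ.real {x} := by
    refine ENNReal.summable_toReal ?_
    have hmass := μ.tsum_indicator_apply_singleton univ MeasurableSet.univ
    simp only [indicator_univ] at hmass
    exact hmass ▸ measure_ne_top _ _
  rw [integral_countable (.of_bound Measurable.of_discrete.aestronglyMeasurable M (ae_of_all _ hM))]
  refine (Summable.of_norm_bounded (hsingle.mul_right M) fun x => ?_).hasSum
  rw [norm_mul, Real.norm_of_nonneg measureReal_nonneg]
  exact mul_le_mul_of_nonneg_left (hM x) measureReal_nonneg

lemma hasSum_measureReal_singleton (μ : Measure α) [IsProbabilityMeasure μ] :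
    HasSum (fun x => μ.real {x}) 1 := by
  simpa using hasSum_measureReal_singleton_mul μ (g := fun _ => 1) fun _ => abs_one.le

lemma hasSum_measureReal_singleton_mul_indicator (μ : Measure α) [IsFiniteMeasure μ] (s : Set α) :
    HasSum (fun x => μ.real {x} * s.indicator 1 x) (μ.real s) := by
  have h := hasSum_measureReal_singleton_mul μ (g := s.indicator 1) (M := 1) fun x => by
    by_cases hx : x ∈ s <;> simp [hx]
  rwa [integral_indicator_one .of_discrete] at h

/-- Scheffé's argument: finite sums of weights bound `P t s` and `P t sᶜ` from below. -/
lemma continuous_measureReal_of_singleton {T : Type*} [TopologicalSpace T] {P : T → Measure α}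
    [∀ t, IsProbabilityMeasure (P t)] (h : ∀ x, Continuous fun t => (P t).real {x}) (s : Set α) :
    Continuous fun t => (P t).real s := by
  have hlower : ∀ (s : Set α) (t : T) (c : ℝ), c < (P t).real s →
      ∀ᶠ r in 𝓝 t, c < (P r).real s := by
    intro s t c hc
    obtain ⟨S, hS⟩ :=
      ((hasSum_measureReal_singleton_mul_indicator (P t) s).eventually_const_lt hc).exists
    have hfinite : Continuous fun r => ∑ x ∈ S, (P r).real {x} * s.indicator 1 x :=
      continuous_finsetSum _ fun x _ => (h x).mul continuous_const
    filter_upwards [hfinite.continuousAt.eventually_const_lt hS] with r hr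
    refine hr.trans_le (sum_le_hasSum _ (fun x _ => ?_)
      (hasSum_measureReal_singleton_mul_indicator (P r) s))
    exact mul_nonneg measureReal_nonneg (indicator_nonneg (by simp) _)
  have hcompl : ∀ r, (P r).real sᶜ = 1 - (P r).real s :=
    fun r => probReal_compl_eq_one_sub .of_discrete
  refine continuous_iff_continuousAt.2 fun t => tendsto_order.2 ⟨hlower s t, fun c hc => ?_⟩
  filter_upwards [hlower sᶜ t (1 - c) (by rw [hcompl]; linarith)] with r hr
  rw [hcompl] at hr
  linarith

lemma abs_integral_sub_tsum_le (μ : Measure α) [IsProbabilityMeasure μ] {s g : α → ℝ} {m M : ℝ}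
    (hs₀ : ∀ x, 0 ≤ s x) (hs : ∀ x, s x ≤ μ.real {x}) (hm : HasSum s m) (hM : ∀ x, |g x| ≤ M) :
    |∫ x, g x ∂μ - ∑' x, s x * g x| ≤ M * (1 - m) := by
  have hsg : Summable fun x => s x * g x := by
    refine Summable.of_norm_bounded (hm.summable.mul_right M) fun x => ?_
    rw [Real.norm_eq_abs, abs_mul, abs_of_nonneg (hs₀ x)]
    exact mul_le_mul_of_nonneg_left (hM x) (hs₀ x)
  rw [← ((hasSum_measureReal_singleton_mul μ hM).sub hsg.hasSum).tsum_eq, ← Real.norm_eq_abs]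
  refine tsum_of_norm_bounded (((hasSum_measureReal_singleton μ).sub hm).mul_left M) fun x => ?_
  rw [← sub_mul, Real.norm_eq_abs, abs_mul, abs_of_nonneg (sub_nonneg.2 (hs x)), mul_comm]
  exact mul_le_mul_of_nonneg_right (hM x) (sub_nonneg.2 (hs x))

end Countable

lemma meanExit_nonneg (p : Measure Config) (a : Species) : 0 ≤ meanExit p a :=
  mul_nonneg (rate_nonneg a) measureReal_nonneg

lemma meanExit_le (p : Measure Config) [IsProbabilityMeasure p] (a : Species) :
    meanExit p a ≤ rate a :=
  mul_le_of_le_one_right (rate_nonneg a) measureReal_le_one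

lemma isRate_arrivalRate (p : Measure Config) [IsProbabilityMeasure p] :
    IsRate (arrivalRate p) := by
  refine ⟨fun a => ?_, ?_⟩
  · have h := meanExit_nonneg p
    cases a
    exacts [add_nonneg (h _) (h _), div_nonneg (h _) zero_le_two, div_nonneg (h _) zero_le_two,
      h _, h _]
  · have h : ∑ a, arrivalRate p a = ∑ a, meanExit p a := by
      simp only [sum_species, arrivalRate]
      ring
    have hrate : ∑ a, rate a = 27 := by norm_num [sum_species, rate]
    rw [h, ← hrate]
    exact Finset.sum_le_sum fun a _ => meanExit_le p a

lemma integral_exitRate (p : Measure Config) (a : Species) :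
    ∫ x, exitRate a x ∂p = meanExit p a := by
  have hind : exitRate a = (busy a).indicator fun _ => rate a := by
    funext x
    simp [exitRate, Set.indicator]
  rw [hind, integral_indicator_const _ .of_discrete, meanExit, smul_eq_mul, mul_comm]

/-- The law of the process at time `t`, frozen at the initial law for negative times, where a
trajectory is unspecified. -/
def law (p : ℝ → ProbabilityMeasure Config) (t : ℝ) : Measure Config := p (max t 0)

instance (p : ℝ → ProbabilityMeasure Config) (t : ℝ) : IsProbabilityMeasure (law p t) :=
  inferInstanceAs (IsProbabilityMeasure (p (max t 0) : Measure Config))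

/-- The arrival rates as functions of time. -/
def arrivals (p : ℝ → ProbabilityMeasure Config) (a : Species) (t : ℝ) : ℝ :=
  arrivalRate (law p t) a

lemma isRate_arrivals (p : ℝ → ProbabilityMeasure Config) (t : ℝ) :
    IsRate fun a => arrivals p a t := isRate_arrivalRate _

section NLMP

variable {p : ℝ → ProbabilityMeasure Config} {t : ℝ}

lemma law_of_nonneg (p : ℝ → ProbabilityMeasure Config) (ht : 0 ≤ t) : law p t = p t := by
  rw [law, max_eq_left ht]

lemma continuous_law (hp : IsNLMP p) (s : Set Config) : Continuous fun t => (law p t).real s := by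
  refine continuous_measureReal_of_singleton (fun x => ?_) s
  have h : ContinuousOn (fun t => (p t : Measure Config).real {x}) (Ici 0) :=
    fun t ht => (hp t ht x).continuousWithinAt
  exact h.comp_continuous (f := fun t => max t 0) (by fun_prop) fun t => le_max_right t 0

lemma continuous_meanExit (hp : IsNLMP p) (a : Species) :
    Continuous fun t => meanExit (law p t) a :=
  continuous_const.mul (continuous_law hp _)

lemma continuous_arrivals (hp : IsNLMP p) (a : Species) : Continuous (arrivals p a) := by
  have h := continuous_meanExit hp
  cases a
  exacts [(h _).add (h _), (h _).div_const 2, (h _).div_const 2, h _, h _]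

lemma hasDerivWithinAt_law (hp : IsNLMP p) (x : Config) (ht : 0 ≤ t) :
    HasDerivWithinAt (fun s => (law p s).real {x}) (forwardRHS (law p t) x) (Ioi t) t := by
  rw [law_of_nonneg p ht]
  refine ((hp t ht x).mono (Ioi_subset_Ici ht)).congr (fun s hs => ?_) ?_
  · rw [law_of_nonneg p (ht.trans (le_of_lt hs))]
  · rw [law_of_nonneg p ht]

lemma continuous_forwardRHS (hp : IsNLMP p) (x : Config) :
    Continuous fun t => forwardRHS (law p t) x := by
  simp only [forwardRHS_eq]
  exact (continuous_inflowOp (continuous_arrivals hp) (fun x => continuous_law hp {x}) x).sub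
    (continuous_const.mul (continuous_law hp {x}))

lemma integral_forwardRHS (hp : IsNLMP p) (x : Config) (ht : 0 ≤ t) :
    ∫ s in (0 : ℝ)..t, forwardRHS (law p s) x = (law p t).real {x} - (law p 0).real {x} :=
  intervalIntegral.integral_eq_sub_of_hasDeriv_right_of_le ht (continuous_law hp _).continuousOn
    (fun _ hs => hasDerivWithinAt_law hp x hs.1.le)
    ((continuous_forwardRHS hp x).intervalIntegrable _ _)

lemma continuous_exp_mul_law (hp : IsNLMP p) (x : Config) :
    Continuous fun t => Real.exp (54 * t) * (law p t).real {x} :=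
  (by fun_prop : Continuous fun t : ℝ => Real.exp (54 * t)).fun_mul (continuous_law hp {x})

/-- In terms of `e ^ (54 t) * p t` the forward equation has no negative terms. -/
lemma integral_inflowOp_exp_mul_law (hp : IsNLMP p) (x : Config) (ht : 0 ≤ t) :
    ∫ s in (0 : ℝ)..t, inflowOp (fun a => arrivals p a s)
        (fun y => Real.exp (54 * s) * (law p s).real {y}) x
      = Real.exp (54 * t) * (law p t).real {x} - (law p 0).real {x} := by
  have hderiv : ∀ s ∈ Ioo 0 t, HasDerivWithinAt (fun s => Real.exp (54 * s) * (law p s).real {x})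
      (inflowOp (fun a => arrivals p a s) (fun y => Real.exp (54 * s) * (law p s).real {y}) x)
      (Ioi s) s := by
    intro s hs
    have hexp : HasDerivAt (fun z : ℝ => Real.exp (54 * z)) (Real.exp (54 * s) * 54) s :=
      ((hasDerivAt_id s).const_mul 54).exp.congr_deriv (by simp)
    refine (hexp.hasDerivWithinAt.fun_mul (hasDerivWithinAt_law hp x hs.1.le)).congr_deriv ?_
    rw [inflowOp_smul, forwardRHS_eq]
    change _ = _ * inflowOp (arrivalRate (law p s)) _ x
    ring
  rw [intervalIntegral.integral_eq_sub_of_hasDeriv_right_of_le ht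
    (continuous_exp_mul_law hp x).continuousOn hderiv
    ((continuous_inflowOp (continuous_arrivals hp) (continuous_exp_mul_law hp) x).intervalIntegrable
      _ _)]
  simp

lemma sum_picard_le (hp : IsNLMP p) (J : Finset Config) (n : ℕ) (ht : 0 ≤ t) (x : Config) :
    ∑ y ∈ J, (law p 0).real {y} * picard (arrivals p) y n t x
      ≤ Real.exp (54 * t) * (law p t).real {x} := by
  have hb := continuous_arrivals hp
  induction n generalizing t x with
  | zero =>
    simp only [picard, mul_zero, Finset.sum_const_zero]
    exact mul_nonneg (Real.exp_pos _).le measureReal_nonneg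
  | succ n ih =>
    have hinitial : ∑ y ∈ J, (law p 0).real {y} * (if x = y then (1 : ℝ) else 0)
        ≤ (law p 0).real {x} := by
      simp only [mul_ite, mul_one, mul_zero, Finset.sum_ite_eq]
      split_ifs
      exacts [le_rfl, measureReal_nonneg]
    have hcont : ∀ y, Continuous fun s => (law p 0).real {y} *
        inflowOp (fun a => arrivals p a s) (picard (arrivals p) y n s) x := fun y =>
      continuous_const.fun_mul (continuous_inflowOp_picard hb n x)
    have hinflow : ∑ y ∈ J, (law p 0).real {y} *
          ∫ s in (0 : ℝ)..t, inflowOp (fun a => arrivals p a s) (picard (arrivals p) y n s) x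
        ≤ ∫ s in (0 : ℝ)..t, inflowOp (fun a => arrivals p a s)
          (fun y => Real.exp (54 * s) * (law p s).real {y}) x := by
      simp only [← intervalIntegral.integral_const_mul]
      rw [← intervalIntegral.integral_finsetSum fun y _ => (hcont y).intervalIntegrable _ _]
      refine intervalIntegral.integral_mono_on ht
        ((continuous_finsetSum _ fun y _ => hcont y).intervalIntegrable _ _)
        ((continuous_inflowOp hb (continuous_exp_mul_law hp) x).intervalIntegrable _ _)
        fun s hs => ?_
      simp only [← inflowOp_smul]
      rw [← inflowOp_sum]
      exact inflowOp_mono (isRate_arrivals p s) (fun z => ih hs.1 z) x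
    simp only [picard, mul_add, Finset.sum_add_distrib]
    linarith [integral_inflowOp_exp_mul_law hp x ht]

end NLMP

/-! ### Dynkin's formula -/

/-- The generator of the process with the arrival rates `β`. -/
def generator (β : Species → ℝ) (g : Config → ℝ) (x : Config) : ℝ :=
  ∑ a, β a * (g (x + unit a) - g x) + ∑ a, exitRate a x * (g (x - unit a) - g x)

lemma generator_eq (β : Species → ℝ) (g : Config → ℝ) (x : Config) :
    generator β g x = adjOp β g x - 54 * g x := by
  simp only [generator, adjOp, mul_sub, Finset.sum_sub_distrib, ← Finset.sum_mul]
  ring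

lemma abs_sum_mul_le {ι : Type*} {s : Finset ι} {c d : ι → ℝ} {C D : ℝ} (hc : ∀ i ∈ s, 0 ≤ c i)
    (hC : ∑ i ∈ s, c i ≤ C) (hd : ∀ i ∈ s, |d i| ≤ D) (hD : 0 ≤ D) :
    |∑ i ∈ s, c i * d i| ≤ C * D :=
  calc |∑ i ∈ s, c i * d i| ≤ ∑ i ∈ s, |c i * d i| := Finset.abs_sum_le_sum_abs _ _
    _ ≤ ∑ i ∈ s, c i * D := Finset.sum_le_sum fun i hi => by
        rw [abs_mul, abs_of_nonneg (hc i hi)]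
        exact mul_le_mul_of_nonneg_left (hd i hi) (hc i hi)
    _ ≤ C * D := by
        rw [← Finset.sum_mul]
        exact mul_le_mul_of_nonneg_right hC hD

lemma abs_generator_le {β : Species → ℝ} (hβ : IsRate β) {g : Config → ℝ} {D : ℝ} (hD : 0 ≤ D)
    {x : Config} (hadd : ∀ a, |g (x + unit a) - g x| ≤ D)
    (hsub : ∀ a, |g (x - unit a) - g x| ≤ D) : |generator β g x| ≤ 54 * D := by
  have harr := abs_sum_mul_le (fun a _ => hβ.nonneg a) hβ.sum_le (fun a _ => hadd a) hD
  have hdep := abs_sum_mul_le (fun a _ => exitRate_nonneg a x) (sum_exitRate_le x)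
    (fun a _ => hsub a) hD
  exact (abs_add_le _ _).trans (by linarith)

lemma hasSum_forwardRHS_mul (P : Measure Config) [IsProbabilityMeasure P] {g : Config → ℝ} {M : ℝ}
    (hM : ∀ x, |g x| ≤ M) :
    HasSum (fun x => forwardRHS P x * g x) (∫ x, generator (arrivalRate P) g x ∂P) := by
  have hM0 : 0 ≤ M := (abs_nonneg _).trans (hM 0)
  have hjump : ∀ x y, |g y - g x| ≤ 2 * M := fun x y =>
    (abs_sub _ _).trans (by linarith [hM x, hM y])
  have hflow := hasSum_inflowOp_mul (arrivalRate P)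
    (hasSum_measureReal_singleton_mul P hM).summable
    (fun a => (hasSum_measureReal_singleton_mul P fun x => hM (x + unit a)).summable)
    (fun a => (hasSum_measureReal_singleton_mul P fun x => hM (x - unit a)).summable)
  have hmean := (hasSum_measureReal_singleton_mul P hM).mul_left 54
  have hgen := hasSum_measureReal_singleton_mul P fun x =>
    abs_generator_le (isRate_arrivalRate P) (by linarith) (fun a => hjump x (x + unit a))
      fun a => hjump x (x - unit a)
  have hadj : HasSum (fun x => P.real {x} * adjOp (arrivalRate P) g x) _ :=
    (hgen.add hmean).congr_fun fun x => by rw [generator_eq]; ring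
  rw [hadj.tsum_eq] at hflow
  have hdiff := hflow.sub hmean
  rw [add_sub_cancel_right] at hdiff
  exact hdiff.congr_fun fun x => by rw [forwardRHS_eq]; ring

/-- A summable bound for the right-hand side of the forward equation. -/
def forwardBound (P : Measure Config) (x : Config) : ℝ :=
  inflowOp (arrivalRate P) (fun y => P.real {y}) x + 54 * P.real {x}

lemma abs_forwardRHS_le (P : Measure Config) [IsProbabilityMeasure P] (x : Config) :
    |forwardRHS P x| ≤ forwardBound P x := by
  have hflow : 0 ≤ inflowOp (arrivalRate P) (fun y => P.real {y}) x :=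
    inflowOp_nonneg (isRate_arrivalRate P) (fun _ => measureReal_nonneg) x
  have hmass : 0 ≤ 54 * P.real {x} := mul_nonneg (by norm_num) measureReal_nonneg
  rw [forwardRHS_eq]
  exact (abs_sub _ _).trans_eq (congrArg₂ (· + ·) (abs_of_nonneg hflow) (abs_of_nonneg hmass))

lemma hasSum_forwardBound (P : Measure Config) [IsProbabilityMeasure P] :
    HasSum (forwardBound P) 108 := by
  have hmass := hasSum_measureReal_singleton P
  have hmass' : HasSum (fun x => P.real {x} * 1) 1 := by simpa only [mul_one] using hmass
  have hflow := hasSum_inflowOp_mul (arrivalRate P) (F := fun _ => 1) hmass'.summable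
    (fun _ => hmass'.summable) fun _ => hmass'.summable
  simp only [adjOp_one, mul_one, tsum_mul_right, hmass.tsum_eq] at hflow
  have h := hflow.add (hmass.mul_left 54)
  norm_num at h
  exact h

/-- The number of customers of class `a`, truncated at `M`. -/
def truncCount (a : Species) (M : ℕ) (x : Config) : ℝ := min (x a : ℝ) M

lemma abs_truncCount_le (a : Species) (M : ℕ) (x : Config) : |truncCount a M x| ≤ M := by
  rw [truncCount, abs_of_nonneg (by positivity)]
  exact min_le_right _ _

lemma abs_natCast_add_unit_sub_le (x : Config) (a c : Species) :
    |(((x + unit c) a : ℕ) : ℝ) - x a| ≤ 1 := by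
  rcases eq_or_ne a c with rfl | h
  · simp
  · simp [h]

lemma abs_natCast_sub_unit_sub_le (x : Config) (a c : Species) :
    |(((x - unit c) a : ℕ) : ℝ) - x a| ≤ 1 := by
  rcases eq_or_ne a c with rfl | h
  · rcases hx : x a with _ | n <;> simp [hx]
  · simp [h]

lemma abs_generator_truncCount_le {β : Species → ℝ} (hβ : IsRate β) (a : Species) (M : ℕ)
    (x : Config) : |generator β (truncCount a M) x| ≤ 54 := by
  simpa using abs_generator_le hβ zero_le_one
    (fun c => (abs_inf_sub_inf_le_abs _ _ _).trans (abs_natCast_add_unit_sub_le x a c))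
    (fun c => (abs_inf_sub_inf_le_abs _ _ _).trans (abs_natCast_sub_unit_sub_le x a c))

lemma generator_truncCount (β : Species → ℝ) {a : Species} {M : ℕ} {x : Config} (hM : x a < M) :
    generator β (truncCount a M) x = β a - exitRate a x := by
  have hM' : (x a : ℝ) + 1 ≤ M := by exact_mod_cast hM
  have hadd : ∀ c, truncCount a M (x + unit c) - truncCount a M x = if a = c then 1 else 0 := by
    intro c
    have := (abs_le.1 (abs_natCast_add_unit_sub_le x a c)).2
    rw [truncCount, truncCount, min_eq_left (by linarith), min_eq_left (by linarith)]
    rcases eq_or_ne a c with rfl | h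
    · simp
    · simp [h]
  have hsub : ∀ c, exitRate c x * (truncCount a M (x - unit c) - truncCount a M x)
      = if a = c then -exitRate a x else 0 := by
    intro c
    have := (abs_le.1 (abs_natCast_sub_unit_sub_le x a c)).2
    rw [truncCount, truncCount, min_eq_left (by linarith), min_eq_left (by linarith)]
    rcases eq_or_ne a c with rfl | h
    · rcases hx : x a with _ | n
      · simp [exitRate_eq_zero hx]
      · simp [hx]
    · simp [h]
  simp only [generator, hsub, hadd]
  simp [sub_eq_add_neg]

section NLMP

variable {p : ℝ → ProbabilityMeasure Config} {t : ℝ}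

theorem dynkin (hp : IsNLMP p) {g : Config → ℝ} {M : ℝ} (hM : ∀ x, |g x| ≤ M) (ht : 0 ≤ t) :
    ∫ x, g x ∂(law p t) - ∫ x, g x ∂(law p 0)
      = ∫ s in (0 : ℝ)..t, ∫ x, generator (fun a => arrivals p a s) g x ∂(law p s) := by
  have hbound : ∀ s, HasSum (fun x => forwardBound (law p s) x * M) (108 * M) := fun s =>
    (hasSum_forwardBound _).mul_right M
  have hintegral := intervalIntegral.hasSum_integral_of_dominated_convergence (μ := volume)
    (a := 0) (b := t) (F := fun x s => forwardRHS (law p s) x * g x)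
    (fun x s => forwardBound (law p s) x * M)
    (fun x => ((continuous_forwardRHS hp x).mul continuous_const).aestronglyMeasurable)
    (fun x => ae_of_all _ fun s _ => ?_) (ae_of_all _ fun s _ => (hbound s).summable)
    (by simp only [fun s => (hbound s).tsum_eq]; exact intervalIntegrable_const)
    (ae_of_all _ fun s _ => hasSum_forwardRHS_mul _ hM)
  · have hdiff := (hasSum_measureReal_singleton_mul (law p t) hM).sub
      (hasSum_measureReal_singleton_mul (law p 0) hM)
    refine hdiff.unique (hintegral.congr_fun fun x => ?_)
    rw [intervalIntegral.integral_mul_const, integral_forwardRHS hp x ht, sub_mul]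
  · rw [norm_mul]
    exact mul_le_mul (abs_forwardRHS_le _ x) (hM x) (abs_nonneg _)
      ((abs_nonneg _).trans (abs_forwardRHS_le _ x))

lemma measurable_integral_generator (hp : IsNLMP p) {g : Config → ℝ} {M : ℝ}
    (hM : ∀ x, |g x| ≤ M) :
    Measurable fun s => ∫ x, generator (fun a => arrivals p a s) g x ∂(law p s) := by
  have hseries : Measurable fun s => ∑' x, forwardRHS (law p s) x * g x :=
    Measurable.tsum fun x => ((continuous_forwardRHS hp x).mul continuous_const).measurable
  simp only [fun s => (hasSum_forwardRHS_mul (law p s) hM).tsum_eq] at hseries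
  exact hseries

lemma tendsto_integral_generator_truncCount (p : ℝ → ProbabilityMeasure Config) (a : Species)
    (s : ℝ) :
    Tendsto (fun M => ∫ x, generator (fun a => arrivals p a s) (truncCount a M) x ∂(law p s)) atTop
      (𝓝 (arrivals p a s - meanExit (law p s) a)) := by
  have hexit : Integrable (exitRate a) (law p s) :=
    .of_bound Measurable.of_discrete.aestronglyMeasurable (rate a) (ae_of_all _ fun x => by
      rw [Real.norm_of_nonneg (exitRate_nonneg a x)]; exact exitRate_le a x)
  have hmean : ∫ x, (arrivals p a s - exitRate a x) ∂(law p s)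
      = arrivals p a s - meanExit (law p s) a := by
    rw [integral_sub (integrable_const _) hexit, integral_exitRate]
    simp
  rw [← hmean]
  refine tendsto_integral_of_dominated_convergence (fun _ => 54)
    (fun M => Measurable.of_discrete.aestronglyMeasurable) (integrable_const _)
    (fun M => ae_of_all _ (abs_generator_truncCount_le (isRate_arrivals p s) a M))
    (ae_of_all _ fun x => tendsto_const_nhds.congr' ?_)
  filter_upwards [eventually_gt_atTop (x a)] with M hM
  exact (generator_truncCount _ hM).symm

/-- The counts themselves need not be integrable. -/
theorem tendsto_balance (hp : IsNLMP p) (a : Species) (ht : 0 ≤ t) :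
    Tendsto (fun M => ∫ x, truncCount a M x ∂(law p t) - ∫ x, truncCount a M x ∂(law p 0)) atTop
      (𝓝 (∫ s in (0 : ℝ)..t, (arrivals p a s - meanExit (law p s) a))) := by
  simp only [fun M => dynkin hp (abs_truncCount_le a M) ht]
  refine intervalIntegral.tendsto_integral_filter_of_dominated_convergence (fun _ => 54)
    (Eventually.of_forall fun M =>
      (measurable_integral_generator hp (abs_truncCount_le a M)).aestronglyMeasurable)
    (Eventually.of_forall fun M => ae_of_all _ fun s _ => ?_) intervalIntegrable_const
    (ae_of_all _ fun s _ => tendsto_integral_generator_truncCount p a s)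
  have hgen : ∀ x, ‖generator (fun a => arrivals p a s) (truncCount a M) x‖ ≤ 54 :=
    abs_generator_truncCount_le (isRate_arrivals p s) a M
  simpa using norm_integral_le_of_norm_le_const (μ := law p s) (ae_of_all _ hgen)

end NLMP

/-! ### The five works -/

/-- A configuration as fluid levels. -/
def toState (x : Config) : State := fun a => x a

lemma toState_mem_orthant (x : Config) : toState x ∈ orthant := fun _ => Nat.cast_nonneg _

/-- The work of a class `c` which is served whatever the other classes. -/
def soloWeight (c a : Species) : ℝ := if a = c then 1 else 0

/-- The work at the node of the light class `l`, which gives way to the heavy class `h`: a customer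
`h` takes five times as long as a customer `l`. -/
def nodeWeight (h l a : Species) : ℝ := if a = h then 5 else if a = l then 1 else 0

lemma sum_soloWeight_mul (c : Species) (f : Species → ℝ) : ∑ a, soloWeight c a * f a = f c := by
  simp [soloWeight]

lemma sum_nodeWeight_mul {h l : Species} (hne : h ≠ l) (f : Species → ℝ) :
    ∑ a, nodeWeight h l a * f a = 5 * f h + f l := by
  have hterm : ∀ a, nodeWeight h l a * f a
      = (if a = h then 5 * f a else 0) + if a = l then f a else 0 := by
    intro a
    unfold nodeWeight
    rcases eq_or_ne a h with rfl | hah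
    · simp [hne]
    · simp [hah]
  simp only [hterm, Finset.sum_add_distrib, Finset.sum_ite_eq', Finset.mem_univ, if_true]

lemma load_soloWeight (c : Species) (x : Config) : load (soloWeight c) x = x c :=
  sum_soloWeight_mul c fun a => (x a : ℝ)

lemma load_nodeWeight {h l : Species} (hne : h ≠ l) (x : Config) :
    load (nodeWeight h l) x = 5 * x h + x l :=
  sum_nodeWeight_mul hne fun a => (x a : ℝ)

lemma isWork_solo {c : Species} (hc : busy c = {x | 0 < x c}) : IsWork (soloWeight c) (rate c) := by
  have hspeed : ∀ x, ∑ a, exitRate a x * soloWeight c a = exitRate c x := fun x => by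
    simp only [mul_comm (exitRate _ x), sum_soloWeight_mul]
  refine ⟨fun a => ?_, fun a => ?_, fun x => (hspeed x).trans_le (exitRate_le c x), fun x hx => ?_⟩
  · unfold soloWeight; split_ifs <;> norm_num
  · unfold soloWeight; split_ifs <;> norm_num
  · rw [load_soloWeight, Nat.cast_ne_zero] at hx
    rw [hspeed]
    exact if_pos (by rw [hc]; exact Nat.pos_of_ne_zero hx)

/-- The speed is constant because `5 * 2 = 10`. -/
lemma isWork_node {h l : Species} (hne : h ≠ l) (hh : busy h = {x | 0 < x h})
    (hl : busy l = {x | 0 < x l ∧ x h = 0}) (rh : rate h = 2) (rl : rate l = 10) :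
    IsWork (nodeWeight h l) 10 := by
  have hspeed : ∀ x, ∑ a, exitRate a x * nodeWeight h l a = 5 * exitRate h x + exitRate l x :=
    fun x => by simp only [mul_comm (exitRate _ x), sum_nodeWeight_mul hne]
  have hheavy : ∀ x : Config, 0 < x h → 5 * exitRate h x + exitRate l x = 10 := fun x hx => by
    norm_num [exitRate, hh, hl, rh, hx, hx.ne']
  have hlight : ∀ x : Config, x h = 0 → 0 < x l → 5 * exitRate h x + exitRate l x = 10 :=
    fun x hxh hxl => by simp [exitRate, hh, hl, rl, hxh, hxl]
  have hempty : ∀ x : Config, x h = 0 → x l = 0 → 5 * exitRate h x + exitRate l x = 0 :=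
    fun x hxh hxl => by simp [exitRate_eq_zero, hxh, hxl]
  refine ⟨fun a => ?_, fun a => ?_, fun x => ?_, fun x hx => ?_⟩
  · unfold nodeWeight; split_ifs <;> norm_num
  · unfold nodeWeight; split_ifs <;> norm_num
  · rw [hspeed]
    rcases (x h).eq_zero_or_pos with hxh | hxh
    · rcases (x l).eq_zero_or_pos with hxl | hxl
      · rw [hempty x hxh hxl]; norm_num
      · exact (hlight x hxh hxl).le
    · exact (hheavy x hxh).le
  · rw [hspeed]
    rcases (x h).eq_zero_or_pos with hxh | hxh
    · refine hlight x hxh (Nat.pos_of_ne_zero fun hxl => hx ?_)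
      simp [load_nodeWeight hne, hxh, hxl]
    · exact hheavy x hxh

section FluidPath

variable {b : Species → ℝ → ℝ} {x₀ : Config}

lemma workLevel_solo (c : Species) (γ : ℝ) :
    workLevel b (soloWeight c) γ x₀ = nodeLevel γ (toState x₀ c) (inflow b c) := by
  simp only [workLevel, virtualWork, sum_soloWeight_mul, load_soloWeight, nodeLevel_eq_reflected,
    toState]

lemma workLevel_node {h l : Species} (hne : h ≠ l) :
    workLevel b (nodeWeight h l) 10 x₀ = nodeWork (inflow b) (toState x₀) h l := by
  simp only [workLevel, virtualWork, sum_nodeWeight_mul hne, load_nodeWeight hne, nodeWork,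
    nodeLevel_eq_reflected, toState]

/-- Cauchy–Schwarz turns the Lyapunov bound into a bound for the mean deviation. -/
lemma picard_abs_load_le {w : Species → ℝ} {γ : ℝ} (hw : IsWork w γ) (hb : ∀ a, Continuous (b a))
    (hr : ∀ t, IsRate fun a => b a t) (n : ℕ) {t : ℝ} (ht : 0 ≤ t) :
    Real.exp (-(54 * t)) * ∑ x ∈ reach x₀ n, picard b x₀ n t x * |load w x - workLevel b w γ x₀ t|
      ≤ √(1350 * t) := by
  set E := Real.exp (-(54 * t))
  set dev := fun x => load w x - workLevel b w γ x₀ t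
  have hE : 0 ≤ E := (Real.exp_pos _).le
  have hq : ∀ x, 0 ≤ picard b x₀ n t x := picard_nonneg hb hr n ht
  have hsq : E * ∑ x ∈ reach x₀ n, picard b x₀ n t x * dev x ^ 2 ≤ 1350 * t := by
    rw [← tsum_picard_mul le_rfl]
    exact lyapunov_le hw hb hr n ht
  have hCS := Finset.sum_sq_le_sum_mul_sum_of_sq_le_mul (reach x₀ n) (fun x _ => hq x)
    (fun x _ => mul_nonneg (hq x) (sq_nonneg (dev x)))
    (r := fun x => picard b x₀ n t x * |dev x|) fun x _ => by
      rw [mul_pow, sq_abs]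
      exact (by ring : _ = _).le
  refine Real.le_sqrt_of_sq_le ?_
  calc (E * ∑ x ∈ reach x₀ n, picard b x₀ n t x * |dev x|) ^ 2
      = E ^ 2 * (∑ x ∈ reach x₀ n, picard b x₀ n t x * |dev x|) ^ 2 := mul_pow _ _ _
    _ ≤ E ^ 2 * _ := mul_le_mul_of_nonneg_left hCS (sq_nonneg _)
    _ = (E * ∑ x ∈ reach x₀ n, picard b x₀ n t x)
          * (E * ∑ x ∈ reach x₀ n, picard b x₀ n t x * dev x ^ 2) := by ring
    _ ≤ 1 * (1350 * t) := mul_le_mul (exp_mul_sum_picard_le hb n ht) hsq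
          (mul_nonneg hE (Finset.sum_nonneg fun x _ => mul_nonneg (hq x) (sq_nonneg _))) zero_le_one
    _ = 1350 * t := one_mul _

lemma abs_sub_sub_five_mul_le (u v W X : ℝ) :
    |v - (W - 5 * X)| ≤ |5 * u + v - W| + 5 * |u - X| :=
  calc |v - (W - 5 * X)| = |(5 * u + v - W) - 5 * (u - X)| := by ring_nf
    _ ≤ |5 * u + v - W| + |5 * (u - X)| := abs_sub _ _
    _ = |5 * u + v - W| + 5 * |u - X| := by rw [abs_mul, abs_of_pos (by norm_num : (0 : ℝ) < 5)]

lemma dist1_toState_fluidLevel_le (x : Config) (t : ℝ) :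
    dist1 (toState x) (fluidLevel (inflow b) (toState x₀) t)
      ≤ |load (soloWeight O) x - workLevel b (soloWeight O) (rate O) x₀ t|
        + 6 * |load (soloWeight AB) x - workLevel b (soloWeight AB) (rate AB) x₀ t|
        + 6 * |load (soloWeight BA) x - workLevel b (soloWeight BA) (rate BA) x₀ t|
        + |load (nodeWeight BA A) x - workLevel b (nodeWeight BA A) 10 x₀ t|
        + |load (nodeWeight AB B) x - workLevel b (nodeWeight AB B) 10 x₀ t| := by
  simp only [load_soloWeight, workLevel_solo, load_nodeWeight (by decide : BA ≠ A),
    load_nodeWeight (by decide : AB ≠ B), workLevel_node (by decide : BA ≠ A),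
    workLevel_node (by decide : AB ≠ B), dist1, sum_species, fluidLevel_A, fluidLevel_B]
  simp only [fluidLevel, rate, toState]
  linarith [abs_sub_sub_five_mul_le (x BA) (x A) (nodeWork (inflow b) (toState x₀) BA A t)
      (nodeLevel 2 (x₀ BA) (inflow b BA) t),
    abs_sub_sub_five_mul_le (x AB) (x B) (nodeWork (inflow b) (toState x₀) AB B t)
      (nodeLevel 2 (x₀ AB) (inflow b AB) t)]

lemma picard_dist1_le (hb : ∀ a, Continuous (b a)) (hr : ∀ t, IsRate fun a => b a t) (n : ℕ)
    {t : ℝ} (ht : 0 ≤ t) :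
    Real.exp (-(54 * t)) * ∑' x, picard b x₀ n t x
        * dist1 (toState x) (fluidLevel (inflow b) (toState x₀) t) ≤ 15 * √(1350 * t) := by
  have hO := picard_abs_load_le (x₀ := x₀) (isWork_solo (c := O) rfl) hb hr n ht
  have hAB := picard_abs_load_le (x₀ := x₀) (isWork_solo (c := AB) rfl) hb hr n ht
  have hBA := picard_abs_load_le (x₀ := x₀) (isWork_solo (c := BA) rfl) hb hr n ht
  have hA := picard_abs_load_le (x₀ := x₀)
    (isWork_node (h := BA) (l := A) (by decide) rfl rfl rfl rfl) hb hr n ht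
  have hB := picard_abs_load_le (x₀ := x₀)
    (isWork_node (h := AB) (l := B) (by decide) rfl rfl rfl rfl) hb hr n ht
  rw [tsum_picard_mul le_rfl]
  refine (mul_le_mul_of_nonneg_left (Finset.sum_le_sum fun x _ => mul_le_mul_of_nonneg_left
    (dist1_toState_fluidLevel_le x t) (picard_nonneg hb hr n ht x)) (Real.exp_pos _).le).trans ?_
  simp only [mul_add, Finset.sum_add_distrib, mul_left_comm _ (6 : ℝ), ← Finset.mul_sum]
  linarith

lemma abs_picard_sub_le (hb : ∀ a, Continuous (b a)) (hr : ∀ t, IsRate fun a => b a t) (n : ℕ)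
    {t : ℝ} (ht : 0 ≤ t) {g : State → ℝ} {L : ℝ} (hL : 0 ≤ L)
    (hg : ∀ x y, |g x - g y| ≤ L * dist1 x y) :
    |Real.exp (-(54 * t)) * ∑' x, picard b x₀ n t x * g (toState x)
        - poissonMass n t * g (fluidLevel (inflow b) (toState x₀) t)| ≤ L * (15 * √(1350 * t)) := by
  set E := Real.exp (-(54 * t))
  set y := fluidLevel (inflow b) (toState x₀) t
  set q := picard b x₀ n t
  have hE : 0 ≤ E := (Real.exp_pos _).le
  have hq : ∀ x, 0 ≤ q x := picard_nonneg hb hr n ht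
  have hdiff : E * ∑' x, q x * g (toState x) - poissonMass n t * g y
      = E * ∑' x, (q x * g (toState x) - q x * g y) := by
    rw [(summable_picard_mul n t _).tsum_sub (summable_picard_mul n t fun _ => g y),
      tsum_mul_right, ← exp_mul_tsum_picard (x₀ := x₀) hb]
    ring
  have hterm : ∀ x, ‖q x * g (toState x) - q x * g y‖ ≤ q x * (L * dist1 (toState x) y) := by
    intro x
    rw [← mul_sub, Real.norm_eq_abs, abs_mul, abs_of_nonneg (hq x)]
    exact mul_le_mul_of_nonneg_left (hg _ _) (hq x)
  calc |E * ∑' x, q x * g (toState x) - poissonMass n t * g y|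
      = E * ‖∑' x, (q x * g (toState x) - q x * g y)‖ := by
        rw [hdiff, abs_mul, abs_of_nonneg hE, Real.norm_eq_abs]
    _ ≤ E * ∑' x, q x * (L * dist1 (toState x) y) := mul_le_mul_of_nonneg_left
        (tsum_of_norm_bounded (summable_picard_mul n t _).hasSum hterm) hE
    _ = L * (E * ∑' x, q x * dist1 (toState x) y) := by
        simp only [mul_left_comm _ L, tsum_mul_left]
    _ ≤ L * (15 * √(1350 * t)) := mul_le_mul_of_nonneg_left (picard_dist1_le hb hr n ht) hL

end FluidPath

/-! ### Comparison with the fluid network -/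

lemma abs_integral_sub_sum_mul_le (P : Measure Config) [IsProbabilityMeasure P] {g : Config → ℝ}
    {M c : ℝ} (hM : ∀ x, |g x| ≤ M) (hc₀ : 0 ≤ c) (hc₁ : c ≤ 1) (J : Finset Config) :
    |∫ x, g x ∂P - ∑ x ∈ J, P.real {x} * (c * g x)| ≤ M * (1 - (∑ x ∈ J, P.real {x}) * c) := by
  have hmass : HasSum (fun x => if x ∈ J then P.real {x} * c else 0)
      ((∑ x ∈ J, P.real {x}) * c) := by
    rw [Finset.sum_mul, ← Finset.sum_congr rfl fun x hx => if_pos hx]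
    exact hasSum_sum_of_ne_finset_zero fun x hx => if_neg hx
  have hsum : ∑' x, (if x ∈ J then P.real {x} * c else 0) * g x
      = ∑ x ∈ J, P.real {x} * (c * g x) := by
    rw [tsum_eq_sum (s := J) fun x hx => by rw [if_neg hx, zero_mul]]
    exact Finset.sum_congr rfl fun x hx => by rw [if_pos hx, mul_assoc]
  rw [← hsum]
  refine abs_integral_sub_tsum_le P (fun x => ?_) (fun x => ?_) hmass hM
  · split_ifs
    exacts [mul_nonneg measureReal_nonneg hc₀, le_rfl]
  · split_ifs
    exacts [mul_le_of_le_one_right measureReal_nonneg hc₁, measureReal_nonneg]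

section Comparison

variable {p : ℝ → ProbabilityMeasure Config} {M L t : ℝ}

/-- The law at time `t` dominates the mixture of the Picard iterates over the initial law. -/
lemma abs_integral_law_sub_picard_le (hp : IsNLMP p) {g : Config → ℝ} (hM : ∀ x, |g x| ≤ M)
    (ht : 0 ≤ t) (J : Finset Config) (n : ℕ) :
    |∫ x, g x ∂(law p t) - ∑ y ∈ J, (law p 0).real {y} *
        (Real.exp (-(54 * t)) * ∑' x, picard (arrivals p) y n t x * g x)|
      ≤ M * (1 - (∑ y ∈ J, (law p 0).real {y}) * poissonMass n t) := by
  let E := Real.exp (-(54 * t))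
  let q := fun y x => picard (arrivals p) y n t x
  let mix := fun x => E * ∑ y ∈ J, (law p 0).real {y} * q y x
  have hq : ∀ y, HasSum (q y) (∑' x, q y x) := fun y => by
    simpa only [mul_one] using
      (summable_picard_mul (b := arrivals p) (x₀ := y) n t fun _ => 1).hasSum
  have hmass : HasSum mix ((∑ y ∈ J, (law p 0).real {y}) * poissonMass n t) := by
    have h := (hasSum_sum fun y (_ : y ∈ J) => (hq y).mul_left ((law p 0).real {y})).mul_left E
    rw [Finset.mul_sum] at h
    simp only [mul_left_comm E, q, E, exp_mul_tsum_picard (continuous_arrivals hp)] at h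
    rwa [← Finset.sum_mul] at h
  have hsum : ∑' x, mix x * g x
      = ∑ y ∈ J, (law p 0).real {y} * (E * ∑' x, q y x * g x) := by
    have h := (hasSum_sum fun y (_ : y ∈ J) => ((summable_picard_mul (b := arrivals p)
      (x₀ := y) n t g).hasSum.mul_left ((law p 0).real {y}))).mul_left E
    simp only [mul_left_comm _ E, ← Finset.mul_sum]
    rw [← h.tsum_eq]
    simp only [mix, q, Finset.sum_mul, mul_assoc]
  rw [← hsum]
  refine abs_integral_sub_tsum_le _ (fun x => mul_nonneg (Real.exp_pos _).le
    (Finset.sum_nonneg fun y _ => mul_nonneg measureReal_nonneg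
      (picard_nonneg (continuous_arrivals hp) (isRate_arrivals p) n ht x))) (fun x => ?_) hmass hM
  simp only [mix, E, Real.exp_neg]
  rw [inv_mul_le_iff₀ (Real.exp_pos _)]
  exact sum_picard_le hp J n ht x

lemma abs_integral_sub_fluid_le_add (hp : IsNLMP p) {g : State → ℝ} (hL : 0 ≤ L)
    (hM : ∀ x, |g x| ≤ M) (hg : ∀ x y, |g x - g y| ≤ L * dist1 x y) (ht : 0 ≤ t)
    (J : Finset Config) (n : ℕ) :
    |∫ x, g (toState x) ∂(law p t)
        - ∫ x, g (fluidLevel (inflow (arrivals p)) (toState x) t) ∂(law p 0)|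
      ≤ L * (15 * √(1350 * t))
        + 2 * (M * (1 - (∑ y ∈ J, (law p 0).real {y}) * poissonMass n t)) := by
  set fluid := fun y => g (fluidLevel (inflow (arrivals p)) (toState y) t)
  set start := fun y => Real.exp (-(54 * t)) * ∑' x, picard (arrivals p) y n t x * g (toState x)
  have hlaw : |∫ x, g (toState x) ∂(law p t) - ∑ y ∈ J, (law p 0).real {y} * start y|
      ≤ M * (1 - (∑ y ∈ J, (law p 0).real {y}) * poissonMass n t) :=
    abs_integral_law_sub_picard_le hp (fun x => hM _) ht J n
  have hinit : |∫ x, fluid x ∂(law p 0)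
        - ∑ y ∈ J, (law p 0).real {y} * (poissonMass n t * fluid y)|
      ≤ M * (1 - (∑ y ∈ J, (law p 0).real {y}) * poissonMass n t) :=
    abs_integral_sub_sum_mul_le (law p 0) (fun x => hM _) (poissonMass_nonneg n ht)
      (poissonMass_le_one n ht) J
  have hpaths : |∑ y ∈ J, (law p 0).real {y} * start y
        - ∑ y ∈ J, (law p 0).real {y} * (poissonMass n t * fluid y)| ≤ L * (15 * √(1350 * t)) := by
    have hJ : ∑ y ∈ J, (law p 0).real {y} ≤ 1 :=
      sum_le_hasSum J (fun _ _ => measureReal_nonneg) (hasSum_measureReal_singleton _)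
    rw [← Finset.sum_sub_distrib]
    simp only [← mul_sub]
    simpa only [one_mul] using abs_sum_mul_le (fun _ _ => measureReal_nonneg) hJ (fun y _ =>
      abs_picard_sub_le (x₀ := y) (continuous_arrivals hp) (isRate_arrivals p) n ht hL hg)
      (by positivity)
  rw [abs_le] at hlaw hinit hpaths ⊢
  constructor <;> linarith

theorem abs_integral_sub_fluid_le (hp : IsNLMP p) {g : State → ℝ} (hL : 0 ≤ L)
    (hM : ∀ x, |g x| ≤ M) (hg : ∀ x y, |g x - g y| ≤ L * dist1 x y) (ht : 0 ≤ t) :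
    |∫ x, g (toState x) ∂(law p t)
        - ∫ x, g (fluidLevel (inflow (arrivals p)) (toState x) t) ∂(law p 0)|
      ≤ L * (15 * √(1350 * t)) := by
  set K := L * (15 * √(1350 * t))
  have hJ : Tendsto (fun J : Finset Config => ∑ y ∈ J, (law p 0).real {y}) atTop (𝓝 1) :=
    hasSum_measureReal_singleton _
  have herror : Tendsto (fun i : Finset Config × ℕ =>
      K + 2 * (M * (1 - (∑ y ∈ i.1, (law p 0).real {y}) * poissonMass i.2 t))) atTop
      (𝓝 (K + 2 * (M * (1 - 1 * 1)))) := by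
    rw [← prod_atTop_atTop_eq]
    exact ((((hJ.comp tendsto_fst).mul ((tendsto_poissonMass t).comp tendsto_snd)).const_sub
      1).const_mul M).const_mul 2 |>.const_add K
  have hle := ge_of_tendsto' herror fun i =>
    abs_integral_sub_fluid_le_add hp hL hM hg ht i.1 i.2
  simpa using hle

end Comparison
/-! ### Mean departures -/

/-- Truncation of the real line to `[-M, M]`, used to make test functions out of coordinates. -/
def clamp (M x : ℝ) : ℝ := max (min x M) (-M)

lemma abs_clamp_le {M : ℝ} (hM : 0 ≤ M) (x : ℝ) : |clamp M x| ≤ M :=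
  abs_le.2 ⟨le_max_right _ _, max_le (min_le_right _ _) (by linarith)⟩

lemma abs_clamp_sub_le (M x y : ℝ) : |clamp M x - clamp M y| ≤ |x - y| :=
  (abs_max_sub_max_le_abs _ _ _).trans (abs_inf_sub_inf_le_abs x y M)

lemma clamp_of_abs_le {M x : ℝ} (h : |x| ≤ M) : clamp M x = x := by
  rw [clamp, min_eq_left (le_of_abs_le h), max_eq_left (neg_le_of_abs_le h)]

lemma clamp_toState (M : ℕ) (x : Config) (a : Species) :
    clamp M (toState x a) = truncCount a M x := by
  have hM : (0 : ℝ) ≤ M := Nat.cast_nonneg M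
  have hmin : (0 : ℝ) ≤ min (x a : ℝ) M := by positivity
  exact max_eq_left ((neg_nonpos.2 hM).trans hmin)

lemma eventually_clamp_natCast_eq (r : ℝ) : ∀ᶠ M : ℕ in atTop, clamp M r = r := by
  filter_upwards [eventually_ge_atTop ⌈|r|⌉₊] with M hM
  exact clamp_of_abs_le (Nat.ceil_le.1 hM)

lemma tendsto_integral_clamp_sub {α : Type*} [MeasurableSpace α] (μ : Measure α)
    [IsFiniteMeasure μ] {f g : α → ℝ} {C : ℝ} (hf : Measurable f) (hg : Measurable g)
    (hfg : ∀ x, |f x - g x| ≤ C) :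
    Tendsto (fun M : ℕ => ∫ x, (clamp M (f x) - clamp M (g x)) ∂μ) atTop
      (𝓝 (∫ x, (f x - g x) ∂μ)) := by
  have hclamp : ∀ M : ℝ, Measurable (clamp M) := fun M =>
    (measurable_id.min measurable_const).max measurable_const
  refine tendsto_integral_of_dominated_convergence (fun _ => C)
    (fun M => (((hclamp M).comp hf).sub ((hclamp M).comp hg)).aestronglyMeasurable)
    (integrable_const _)
    (fun M => ae_of_all _ fun x => (abs_clamp_sub_le _ _ _).trans (hfg x)) (ae_of_all _ fun x => ?_)
  refine tendsto_const_nhds.congr' ?_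
  filter_upwards [eventually_clamp_natCast_eq (f x), eventually_clamp_natCast_eq (g x)] with M hf hg
  rw [hf, hg]

section Departures

variable {p : ℝ → ProbabilityMeasure Config} {t : ℝ}

lemma abs_truncCount_sub_clamp_le (hp : IsNLMP p) (a : Species) (ht : 0 ≤ t) (M : ℕ) :
    |(∫ x, truncCount a M x ∂(law p t) - ∫ x, truncCount a M x ∂(law p 0))
        - ∫ x, (clamp M (fluidLevel (inflow (arrivals p)) (toState x) t a)
          - clamp M (toState x a)) ∂(law p 0)|
      ≤ 15 * √(1350 * t) := by
  have hM : ∀ r, |clamp M r| ≤ M := abs_clamp_le (Nat.cast_nonneg M)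
  have hint : ∀ f : Config → ℝ, Integrable (fun x => clamp M (f x)) (law p 0) := fun f =>
    .of_bound Measurable.of_discrete.aestronglyMeasurable M (ae_of_all _ fun x => hM _)
  have h := abs_integral_sub_fluid_le hp (g := fun x => clamp M (x a)) zero_le_one
    (fun x => hM _) (fun x y => (abs_clamp_sub_le _ _ _).trans
      ((abs_sub_le_dist1 x y a).trans_eq (one_mul _).symm)) ht
  rw [one_mul] at h
  rw [integral_sub (hint _) (hint _)]
  simp only [clamp_toState] at h ⊢
  rwa [sub_sub_sub_cancel_right]

/-- Departures are arrivals minus the growth of the queue, for the process as for the fluid. -/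
theorem abs_departures_sub_outflow_le (hp : IsNLMP p) (a : Species) (ht : 0 ≤ t) :
    |(∫ s in (0 : ℝ)..t, meanExit (law p s) a)
        - ∫ x, outflow (inflow (arrivals p)) (toState x) t a ∂(law p 0)|
      ≤ 15 * √(1350 * t) := by
  set Y := inflow (arrivals p)
  have hY : ∀ a, ∀ s ∈ Icc 0 t, 0 ≤ Y a s := fun a s hs =>
    inflow_nonneg (continuous_arrivals hp) (isRate_arrivals p) a hs.1
  have hout : ∀ x : Config, |outflow Y (toState x) t a| ≤ 10 * t := fun x =>
    abs_outflow_le ht hY (toState_mem_orthant x) a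
  have hgrowth : ∀ x : Config, fluidLevel Y (toState x) t a - toState x a
      = Y a t - outflow Y (toState x) t a := fun x => by rw [outflow]; ring
  have hfluid := tendsto_integral_clamp_sub (law p 0) (C := |Y a t| + 10 * t)
    (f := fun x => fluidLevel Y (toState x) t a) (g := fun x => toState x a) .of_discrete
    .of_discrete fun x => by
      rw [hgrowth]; exact (abs_sub _ _).trans (add_le_add_right (hout x) _)
  have hle := le_of_tendsto' ((tendsto_balance hp a ht).sub hfluid).abs
    (abs_truncCount_sub_clamp_le hp a ht)
  simp only [hgrowth] at hle
  have hprocess : ∫ s in (0 : ℝ)..t, (arrivals p a s - meanExit (law p s) a)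
      = Y a t - ∫ s in (0 : ℝ)..t, meanExit (law p s) a :=
    intervalIntegral.integral_sub ((continuous_arrivals hp a).intervalIntegrable _ _)
      ((continuous_meanExit hp a).intervalIntegrable _ _)
  have hmean : ∫ x, (Y a t - outflow Y (toState x) t a) ∂(law p 0)
      = Y a t - ∫ x, outflow Y (toState x) t a ∂(law p 0) := by
    rw [integral_sub (integrable_const _) (.of_bound
      Measurable.of_discrete.aestronglyMeasurable (10 * t) (ae_of_all _ hout))]
    simp
  rwa [hprocess, hmean, sub_sub_sub_cancel_left, abs_sub_comm] at hle

end Departures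

/-! ### Bounded Lipschitz test functions -/

/-- Test functions for the KROV convergence: bounded by `M`, and Lipschitz with constant `L > 0` for
the `ℓ¹` distance. -/
structure IsTest (M L : ℝ) (g : State → ℝ) : Prop where
  abs_le : ∀ x, |g x| ≤ M
  abs_sub_le : ∀ x y, |g x - g y| ≤ L * dist1 x y
  pos : 0 < L

lemma dist1_le_dist (x y : State) : dist1 x y ≤ 5 * dist x y := by
  have h := fun a => dist_le_pi_dist x y a
  simp only [Real.dist_eq] at h
  rw [dist1, sum_species]
  linarith [h O, h A, h B, h AB, h BA]

lemma dist_le_dist1 (x y : State) : dist x y ≤ dist1 x y :=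
  (dist_pi_le_iff (Finset.sum_nonneg fun _ _ => abs_nonneg _)).2 fun a => abs_sub_le_dist1 x y a

lemma ofReal_dist1 (x y : State) : ENNReal.ofReal (dist1 x y) = ∑ a, edist (x a) (y a) := by
  rw [dist1, ENNReal.ofReal_sum_of_nonneg fun _ _ => abs_nonneg _]
  simp only [edist_dist, Real.dist_eq]

lemma uniformContinuous_of_abs_sub_le {g : State → ℝ} {L : ℝ} (hL : 0 ≤ L)
    (hg : ∀ x y, |g x - g y| ≤ L * dist1 x y) : UniformContinuous g := by
  refine (LipschitzWith.of_dist_le_mul (K := (L * 5).toNNReal) fun x y => ?_).uniformContinuous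
  rw [Real.coe_toNNReal _ (by positivity), mul_assoc]
  exact (hg x y).trans (mul_le_mul_of_nonneg_left (dist1_le_dist x y) hL)

namespace IsTest

variable {M L : ℝ} {g : State → ℝ}

lemma uniformContinuous (h : IsTest M L g) : UniformContinuous g :=
  uniformContinuous_of_abs_sub_le h.pos.le h.abs_sub_le

lemma measurable (h : IsTest M L g) : Measurable g := h.uniformContinuous.continuous.measurable

lemma integrable (h : IsTest M L g) (μ : Measure State) [IsFiniteMeasure μ] : Integrable g μ :=
  .of_bound h.measurable.aestronglyMeasurable M (ae_of_all _ h.abs_le)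

lemma ofReal_abs_integral_sub_le_coupling (h : IsTest M L g) (κ : Measure (State × State))
    [IsFiniteMeasure κ] :
    ENNReal.ofReal |∫ x, g x ∂κ.map Prod.fst - ∫ x, g x ∂κ.map Prod.snd|
      ≤ ENNReal.ofReal L * ∫⁻ z, ∑ a, edist (z.1 a) (z.2 a) ∂κ := by
  have hint : ∀ f : State × State → State, Measurable f → Integrable (fun z => g (f z)) κ :=
    fun f hf => .of_bound (h.measurable.comp hf).aestronglyMeasurable M
      (ae_of_all _ fun z => h.abs_le _)
  rw [integral_map measurable_fst.aemeasurable h.measurable.aestronglyMeasurable,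
    integral_map measurable_snd.aemeasurable h.measurable.aestronglyMeasurable,
    ← integral_sub (hint _ measurable_fst) (hint _ measurable_snd),
    ← lintegral_const_mul' _ _ ENNReal.ofReal_ne_top, ← Real.enorm_eq_ofReal_abs]
  refine (enorm_integral_le_lintegral_enorm _).trans (lintegral_mono fun z => ?_)
  rw [Real.enorm_eq_ofReal_abs, ← ofReal_dist1, ← ENNReal.ofReal_mul h.pos.le]
  exact ENNReal.ofReal_le_ofReal (h.abs_sub_le _ _)

lemma ofReal_abs_integral_sub_le (h : IsTest M L g) (μ ν : ProbabilityMeasure State) :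
    ENNReal.ofReal |∫ x, g x ∂(μ : Measure State) - ∫ x, g x ∂(ν : Measure State)|
      ≤ ENNReal.ofReal L * krov μ ν := by
  have hL : ENNReal.ofReal L ≠ 0 := by simpa using h.pos
  simp only [krov, ENNReal.mul_iInf_of_ne hL ENNReal.ofReal_ne_top]
  refine le_iInf₂ fun κ hκ => ?_
  obtain ⟨hfst, hsnd⟩ := hκ
  have hprob : IsProbabilityMeasure (κ.map Prod.fst) := hfst ▸ inferInstance
  have : IsProbabilityMeasure κ := Measure.isProbabilityMeasure_of_map Prod.fst
  rw [← hfst, ← hsnd]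
  exact h.ofReal_abs_integral_sub_le_coupling κ

lemma tendsto_integral (h : IsTest M L g) {ι : Type*} {l : Filter ι}
    {μ : ι → ProbabilityMeasure State} {ν : ProbabilityMeasure State}
    (hk : Tendsto (fun i => krov (μ i) ν) l (𝓝 0)) :
    Tendsto (fun i => ∫ x, g x ∂(μ i : Measure State)) l (𝓝 (∫ x, g x ∂(ν : Measure State))) := by
  have hbound : Tendsto (fun i => ENNReal.ofReal L * krov (μ i) ν) l (𝓝 0) := by
    simpa using ENNReal.Tendsto.const_mul hk (Or.inr ENNReal.ofReal_ne_top)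
  rw [tendsto_iff_edist_tendsto_0]
  refine tendsto_of_tendsto_of_tendsto_of_le_of_le tendsto_const_nhds hbound
    (fun i => zero_le) fun i => ?_
  rw [edist_dist, Real.dist_eq]
  exact h.ofReal_abs_integral_sub_le (μ i) ν

lemma tendsto_integral_of_tendstoUniformly {ι : Type*} {l : Filter ι} {gk : ι → State → ℝ}
    (hg : IsTest M L g) (hgk : ∀ k, IsTest M L (gk k)) (hlim : TendstoUniformly gk g l)
    {μ : ι → ProbabilityMeasure State} {ν : ProbabilityMeasure State}
    (hk : Tendsto (fun k => krov (μ k) ν) l (𝓝 0)) :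
    Tendsto (fun k => ∫ x, gk k x ∂(μ k : Measure State)) l
      (𝓝 (∫ x, g x ∂(ν : Measure State))) := by
  have hdiff : Tendsto (fun k => ∫ x, gk k x ∂(μ k : Measure State)
      - ∫ x, g x ∂(μ k : Measure State)) l (𝓝 0) := by
    refine Metric.tendsto_nhds.2 fun ε hε => ?_
    filter_upwards [Metric.tendstoUniformly_iff.1 hlim (ε / 2) (half_pos hε)] with k hk
    rw [dist_zero_right, ← integral_sub ((hgk k).integrable _) (hg.integrable _)]
    have h := norm_integral_le_of_norm_le_const (μ := (μ k : Measure State)) (ae_of_all _ fun x =>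
      (dist_eq_norm (gk k x) (g x)).symm.trans_le ((dist_comm _ _).trans_le (hk x).le))
    rw [probReal_univ, mul_one] at h
    linarith
  simpa using hdiff.add (hg.tendsto_integral hk)

end IsTest

lemma eq_of_forall_isTest {μ ν : ProbabilityMeasure State}
    (h : ∀ M L g, IsTest M L g → ∫ x, g x ∂(μ : Measure State) = ∫ x, g x ∂(ν : Measure State)) :
    μ = ν := by
  suffices hlim : Tendsto (fun _ : ℕ => μ) atTop (𝓝 ν) from
    tendsto_nhds_unique tendsto_const_nhds hlim
  rw [tendsto_iff_forall_lipschitz_integral_tendsto]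
  rintro f ⟨C, hC⟩ ⟨L, hL⟩
  have hf : IsTest (C + |f 0|) (L + 1) f := by
    refine ⟨fun x => ?_, fun x y => ?_, by positivity⟩
    · have hx := hC x 0
      rw [Real.dist_eq] at hx
      linarith [abs_sub_abs_le_abs_sub (f x) (f 0)]
    · rw [← Real.dist_eq]
      exact (hL.dist_le_mul x y).trans (mul_le_mul (by simp) (dist_le_dist1 x y) dist_nonneg
        (by positivity))
  rw [h _ _ f hf]
  exact tendsto_const_nhds

lemma krov_limit_unique {ι : Type*} {l : Filter ι} [l.NeBot] {μ : ι → ProbabilityMeasure State}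
    {ν ν' : ProbabilityMeasure State} (h : Tendsto (fun i => krov (μ i) ν) l (𝓝 0))
    (h' : Tendsto (fun i => krov (μ i) ν') l (𝓝 0)) : ν = ν' :=
  eq_of_forall_isTest fun _ _ _ hg =>
    tendsto_nhds_unique (hg.tendsto_integral h) (hg.tendsto_integral h')

/-! ### Euler scaling -/

lemma integral_scaled {N : ℕ} (q : ProbabilityMeasure Config) {g : State → ℝ} (hg : Measurable g) :
    ∫ x, g x ∂(scaled N q : Measure State)
      = ∫ x, g (fun a => toState x a / N) ∂(q : Measure Config) :=
  integral_map (φ := fun (x : Config) a => (x a : ℝ) / N) Measurable.of_discrete.aemeasurable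
    hg.aestronglyMeasurable

/-- The mean inflows of the process, rescaled in space and time. -/
def scaledInflow (N : ℕ) (p : ℝ → ProbabilityMeasure Config) (a : Species) (t : ℝ) : ℝ :=
  inflow (arrivals p) a (N * t) / N

/-- The mean numbers of departures in the process, rescaled in space and time. -/
def scaledDepartures (N : ℕ) (p : ℝ → ProbabilityMeasure Config) (a : Species) (t : ℝ) : ℝ :=
  (∫ s in (0 : ℝ)..(N * t), meanExit (law p s) a) / N

lemma dist1_div {c : ℝ} (hc : 0 < c) (x y : State) :
    dist1 (fun a => x a / c) (fun a => y a / c) = dist1 x y / c := by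
  simp only [dist1, ← sub_div, abs_div, abs_of_pos hc, Finset.sum_div]

section OneInflow

variable {Y : Species → ℝ → ℝ} {t : ℝ}

lemma isTest_comp_fluidLevel {M L : ℝ} {g : State → ℝ} (hg : IsTest M L g) (ht : 0 ≤ t)
    (hY : ∀ a, ∀ s ∈ Icc 0 t, 0 ≤ Y a s) : IsTest M (L * 22) fun x => g (fluidLevel Y x t) := by
  refine ⟨fun x => hg.abs_le _, fun x y => (hg.abs_sub_le _ _).trans ?_,
    mul_pos hg.pos (by norm_num)⟩
  rw [mul_assoc]
  refine mul_le_mul_of_nonneg_left ?_ hg.pos.le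
  simpa using dist1_fluidLevel_le (d := 0) ht hY hY (by simp) x y

lemma isTest_clamp_outflow {K : ℝ} (hK : 0 ≤ K) (ht : 0 ≤ t)
    (hY : ∀ a, ∀ s ∈ Icc 0 t, 0 ≤ Y a s) (a : Species) :
    IsTest K 23 fun x => clamp K (outflow Y x t a) := by
  refine ⟨fun x => abs_clamp_le hK _, fun x y => (abs_clamp_sub_le _ _ _).trans ?_, by norm_num⟩
  simpa using abs_outflow_sub_le (d := 0) ht hY hY (by simp) x y a

lemma measurable_fluidLevel (ht : 0 ≤ t) (hY : ∀ a, ∀ s ∈ Icc 0 t, 0 ≤ Y a s) :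
    Measurable fun x => fluidLevel Y x t := by
  refine measurable_pi_iff.2 fun a => (uniformContinuous_of_abs_sub_le (L := 22) (by norm_num)
    fun x y => ?_).continuous.measurable
  refine (abs_sub_le_dist1 _ _ a).trans ?_
  simpa using dist1_fluidLevel_le (d := 0) ht hY hY (by simp) x y

end OneInflow

section Scaled

variable {p : ℝ → ProbabilityMeasure Config} {N : ℕ} {t : ℝ}

lemma scaledInflow_zero (a : Species) : scaledInflow N p a 0 = 0 := by
  rw [scaledInflow, mul_zero, inflow_zero, zero_div]

lemma monotone_scaledInflow (hp : IsNLMP p) (a : Species) : Monotone (scaledInflow N p a) :=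
  fun _ _ hst => div_le_div_of_nonneg_right (monotone_inflow (continuous_arrivals hp)
    (isRate_arrivals p) a (mul_le_mul_of_nonneg_left hst N.cast_nonneg)) N.cast_nonneg

lemma lipschitzWith_scaledInflow (hp : IsNLMP p) (hN : 0 < N) (a : Species) :
    LipschitzWith 27 (scaledInflow N p a) := by
  have hN' : (0 : ℝ) < N := Nat.cast_pos.2 hN
  refine LipschitzWith.of_dist_le_mul fun s t => ?_
  have h := (lipschitzWith_inflow (continuous_arrivals hp) (isRate_arrivals p) a).dist_le_mul
    (N * s) (N * t)
  rw [Real.dist_eq, Real.dist_eq, ← mul_sub, abs_mul, abs_of_pos hN'] at h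
  rw [Real.dist_eq, Real.dist_eq, scaledInflow, scaledInflow, ← sub_div, abs_div, abs_of_pos hN',
    div_le_iff₀ hN']
  linarith

lemma scaledInflow_nonneg (hp : IsNLMP p) (a : Species) (ht : 0 ≤ t) : 0 ≤ scaledInflow N p a t :=
  (scaledInflow_zero a).symm.trans_le (monotone_scaledInflow hp a ht)

lemma fluidLevel_scaledInflow (hN : 0 < N) (x : Config) (t : ℝ) :
    fluidLevel (scaledInflow N p) (fun a => toState x a / N) t
      = fun a => fluidLevel (inflow (arrivals p)) (toState x) (N * t) a / N :=
  funext fun _ => fluidLevel_scale (Nat.cast_pos.2 hN) (fun _ _ => rfl) _ _ _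

lemma outflow_scaledInflow (hN : 0 < N) (x : Config) (t : ℝ) (a : Species) :
    outflow (scaledInflow N p) (fun a => toState x a / N) t a
      = outflow (inflow (arrivals p)) (toState x) (N * t) a / N := by
  rw [outflow, fluidLevel_scaledInflow hN, outflow, scaledInflow]
  ring

lemma abs_integral_scaled_sub_le (hp : IsNLMP p) (hN : 0 < N) {M L : ℝ} {g : State → ℝ}
    (hg : IsTest M L g) (ht : 0 ≤ t) :
    |∫ x, g x ∂(scaled N (p (N * t)) : Measure State)
        - ∫ x, g (fluidLevel (scaledInflow N p) x t) ∂(scaled N (p 0) : Measure State)|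
      ≤ L * (15 * √(1350 * (N * t)) / N) := by
  have hN' : (0 : ℝ) < N := Nat.cast_pos.2 hN
  have hNt : 0 ≤ N * t := by positivity
  have hmeas : Measurable fun x => g (fluidLevel (scaledInflow N p) x t) :=
    (isTest_comp_fluidLevel hg ht fun a s hs => scaledInflow_nonneg hp a hs.1).measurable
  have h := abs_integral_sub_fluid_le hp (g := fun x => g fun a => x a / N) (L := L / N)
    (div_nonneg hg.pos.le hN'.le) (fun x => hg.abs_le _)
    (fun x y => (hg.abs_sub_le _ _).trans_eq (by rw [dist1_div hN']; ring)) hNt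
  rw [law_of_nonneg p hNt, law_of_nonneg p le_rfl] at h
  rw [integral_scaled _ hg.measurable, integral_scaled _ hmeas]
  simp only [fluidLevel_scaledInflow hN]
  exact h.trans_eq (by ring)

lemma abs_scaledDepartures_sub_le (hp : IsNLMP p) (hN : 0 < N) (a : Species) (ht : 0 ≤ t) :
    |scaledDepartures N p a t - ∫ x, clamp (10 * t) (outflow (scaledInflow N p) x t a)
        ∂(scaled N (p 0) : Measure State)|
      ≤ 15 * √(1350 * (N * t)) / N := by
  have hN' : (0 : ℝ) < N := Nat.cast_pos.2 hN
  have hY : ∀ a, ∀ s ∈ Icc 0 t, 0 ≤ scaledInflow N p a s := fun a s hs =>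
    scaledInflow_nonneg hp a hs.1
  have hclamp : ∀ x : Config,
      clamp (10 * t) (outflow (scaledInflow N p) (fun a => toState x a / N) t a)
        = outflow (inflow (arrivals p)) (toState x) (N * t) a / N := fun x => by
    rw [clamp_of_abs_le, outflow_scaledInflow hN]
    exact abs_outflow_le ht hY (fun a => div_nonneg (toState_mem_orthant x a) hN'.le) a
  have h := abs_departures_sub_outflow_le hp a (mul_nonneg hN'.le ht)
  rw [integral_scaled _ (isTest_clamp_outflow (by linarith) ht hY a).measurable, scaledDepartures]
  simp only [hclamp]
  rw [integral_div, ← sub_div, abs_div, abs_of_pos hN', ← law_of_nonneg p le_rfl]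
  exact div_le_div_of_nonneg_right h hN'.le

lemma scaledInflow_O (hp : IsNLMP p) (t : ℝ) :
    scaledInflow N p O t = scaledDepartures N p AB t + scaledDepartures N p BA t := by
  have hint := fun a => (continuous_meanExit hp a).intervalIntegrable (μ := volume) 0 (N * t)
  rw [scaledDepartures, scaledDepartures, ← add_div,
    ← intervalIntegral.integral_add (hint AB) (hint BA)]
  rfl

lemma scaledInflow_A (p : ℝ → ProbabilityMeasure Config) (N : ℕ) (t : ℝ) :
    scaledInflow N p A t = 1 / 2 * scaledDepartures N p O t := by
  have h : inflow (arrivals p) A (N * t) = (∫ s in (0 : ℝ)..(N * t), meanExit (law p s) O) / 2 :=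
    intervalIntegral.integral_div _ _
  rw [scaledInflow, scaledDepartures, h]
  ring

lemma scaledInflow_B (p : ℝ → ProbabilityMeasure Config) (N : ℕ) (t : ℝ) :
    scaledInflow N p B t = 1 / 2 * scaledDepartures N p O t :=
  scaledInflow_A p N t

end Scaled

lemma tendsto_sqrt_mul_div (C c t : ℝ) :
    Tendsto (fun N : ℕ => C * √(c * (N * t)) / N) atTop (𝓝 0) := by
  have h : ∀ N : ℕ, C * √(c * (N * t)) / N = C * √(c * t) * (√N)⁻¹ := fun N => by
    rw [mul_left_comm, Real.sqrt_mul N.cast_nonneg, ← Real.sqrt_div_self, div_eq_mul_inv]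
    ring
  have hinv : Tendsto (fun N : ℕ => (√(N : ℝ))⁻¹) atTop (𝓝 0) :=
    (Real.tendsto_sqrt_atTop.comp tendsto_natCast_atTop_atTop).inv_tendsto_atTop
  simpa [h] using hinv.const_mul (C * √(c * t))

/-! ### Compactness of the inflows -/

lemma exists_subseq_tendstoUniformlyOn {E : Type*} [MetricSpace E] [ProperSpace E] {K : ℝ≥0}
    {T : ℝ} (hT : 0 ≤ T) {e : E} {f : ℕ → ℝ → E} (h0 : ∀ k, f k 0 = e)
    (hf : ∀ k, LipschitzWith K (f k)) :
    ∃ ψ : ℕ → ℕ, StrictMono ψ ∧ ∃ g : ℝ → E,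
      TendstoUniformlyOn (fun k => f (ψ k)) g atTop (Icc 0 T) := by
  let F : ℕ → BoundedContinuousFunction (Icc 0 T) E := fun k =>
    BoundedContinuousFunction.mkOfCompact ⟨fun t => f k t, (hf k).continuous.comp
      continuous_subtype_val⟩
  have hF : ∀ k, LipschitzWith K (F k) := fun k => LipschitzWith.of_dist_le_mul fun x y =>
    (hf k).dist_le_mul x y
  have hcomp : IsCompact (closure (Set.range F)) := by
    refine BoundedContinuousFunction.arzela_ascoli (Metric.closedBall e (K * T))
      (isCompact_closedBall _ _) _ ?_ ?_
    · rintro _ x ⟨k, rfl⟩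
      have h := (hf k).dist_le_mul x 0
      rw [h0, Real.dist_eq, sub_zero, abs_of_nonneg x.2.1] at h
      exact Metric.mem_closedBall.2 (h.trans (mul_le_mul_of_nonneg_left x.2.2 K.coe_nonneg))
    · refine (LipschitzWith.uniformEquicontinuous _ K ?_).equicontinuous
      rintro ⟨_, k, rfl⟩
      exact hF k
  obtain ⟨G, -, ψ, hψ, hG⟩ := hcomp.tendsto_subseq fun k => subset_closure ⟨k, rfl⟩
  refine ⟨ψ, hψ, IccExtend hT G, Metric.tendstoUniformlyOn_iff.2 fun ε hε => ?_⟩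
  filter_upwards [Metric.tendsto_nhds.1 hG ε hε] with k hk t ht
  rw [IccExtend_of_mem hT _ ht, dist_comm]
  exact (BoundedContinuousFunction.dist_coe_le_dist (⟨t, ht⟩ : Icc 0 T)).trans_lt hk

lemma isNetInflow_of_tendsto {K : ℝ≥0} {T : ℝ} (hT : 0 ≤ T) {f : ℕ → Species → ℝ → ℝ}
    {Y : Species → ℝ → ℝ} (h0 : ∀ k a, f k a 0 = 0) (hmono : ∀ k a, Monotone (f k a))
    (hlip : ∀ k a, LipschitzWith K (f k a))
    (hlim : ∀ a, ∀ t ∈ Icc 0 T, Tendsto (fun k => f k a t) atTop (𝓝 (Y a t))) :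
    IsNetInflow T Y where
  zero a := tendsto_nhds_unique (hlim a 0 (left_mem_Icc.2 hT))
    (by simp only [h0, tendsto_const_nhds])
  mono a s hs t ht hst :=
    le_of_tendsto_of_tendsto' (hlim a s hs) (hlim a t ht) fun k => hmono k a hst
  lipschitz := ⟨K, fun a => LipschitzOnWith.of_dist_le_mul fun s hs t ht =>
    le_of_tendsto' ((hlim a s hs).dist (hlim a t ht)) fun k => (hlip k a).dist_le_mul s t⟩

lemma exists_subseq_tendsto_netInflow {K : ℝ≥0} {T : ℝ} (hT : 0 ≤ T) {f : ℕ → Species → ℝ → ℝ}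
    (h0 : ∀ k a, f k a 0 = 0) (hmono : ∀ k a, Monotone (f k a))
    (hlip : ∀ k a, LipschitzWith K (f k a)) :
    ∃ ψ : ℕ → ℕ, StrictMono ψ ∧ ∃ Y : Species → ℝ → ℝ, IsNetInflow T Y ∧
      ∀ a, TendstoUniformlyOn (fun k => f (ψ k) a) (Y a) atTop (Icc 0 T) := by
  obtain ⟨ψ, hψ, g, hg⟩ := exists_subseq_tendstoUniformlyOn hT (e := (0 : State))
    (f := fun k t a => f k a t) (fun k => funext fun a => h0 k a)
    fun k => LipschitzWith.of_dist_le_mul fun s t =>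
      (dist_pi_le_iff (by positivity)).2 fun a => (hlip k a).dist_le_mul s t
  have hlim : ∀ a, TendstoUniformlyOn (fun k => f (ψ k) a) (fun t => g t a) atTop (Icc 0 T) :=
    fun a => (Pi.uniformContinuous_proj _ a).comp_tendstoUniformlyOn hg
  exact ⟨ψ, hψ, fun a t => g t a, isNetInflow_of_tendsto hT (fun k => h0 (ψ k))
    (fun k => hmono (ψ k)) (fun k => hlip (ψ k)) fun a t ht => (hlim a).tendsto_at ht, hlim⟩

/-! ### Passage to the limit -/

/-- A test function which vanishes exactly on the orthant. -/
def orthantGap (x : State) : ℝ := min (∑ a, max (-x a) 0) 1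

lemma orthantGap_nonneg (x : State) : 0 ≤ orthantGap x :=
  le_min (Finset.sum_nonneg fun _ _ => le_max_right _ _) zero_le_one

lemma orthantGap_eq_zero_iff {x : State} : orthantGap x = 0 ↔ x ∈ orthant := by
  have hsum : ∑ a, max (-x a) 0 = 0 ↔ x ∈ orthant := by
    rw [Finset.sum_eq_zero_iff_of_nonneg fun a _ => le_max_right _ _]
    simp [orthant]
  rw [← hsum, orthantGap]
  refine ⟨fun h => ?_, fun h => by rw [h, min_eq_left zero_le_one]⟩
  rcases min_choice (∑ a, max (-x a) 0) 1 with hmin | hmin <;> linarith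

lemma isTest_orthantGap : IsTest 1 1 orthantGap := by
  refine ⟨fun x => ?_, fun x y => (abs_inf_sub_inf_le_abs _ _ _).trans ?_, one_pos⟩
  · rw [abs_of_nonneg (orthantGap_nonneg x)]
    exact min_le_right _ _
  · rw [one_mul, ← Finset.sum_sub_distrib]
    refine (Finset.abs_sum_le_sum_abs _ _).trans (Finset.sum_le_sum fun a _ => ?_)
    refine (abs_max_sub_max_le_abs _ _ _).trans_eq ?_
    rw [neg_sub_neg, abs_sub_comm]

lemma ae_mem_orthant_of_krov {n : ℕ → ℕ} {q : ℕ → ProbabilityMeasure Config}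
    {ν : ProbabilityMeasure State}
    (hk : Tendsto (fun k => krov (scaled (n k) (q k)) ν) atTop (𝓝 0)) :
    ∀ᵐ x ∂(ν : Measure State), x ∈ orthant := by
  have hzero : ∀ k, ∫ x, orthantGap x ∂(scaled (n k) (q k) : Measure State) = 0 := fun k => by
    have hmem : ∀ x : Config, (fun a => toState x a / n k) ∈ orthant := fun x a =>
      div_nonneg (toState_mem_orthant x a) (n k).cast_nonneg
    simp [integral_scaled _ isTest_orthantGap.measurable, orthantGap_eq_zero_iff.2 (hmem _)]
  have hlim := isTest_orthantGap.tendsto_integral hk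
  simp only [hzero] at hlim
  have hgap := (integral_eq_zero_iff_of_nonneg orthantGap_nonneg
    (isTest_orthantGap.integrable _)).1 (tendsto_nhds_unique hlim tendsto_const_nhds)
  filter_upwards [hgap] with x hx using orthantGap_eq_zero_iff.1 hx

lemma IsNetInflow.nonneg {T t : ℝ} {Y : Species → ℝ → ℝ} (hY : IsNetInflow T Y)
    (ht : t ∈ Icc 0 T) (a : Species) : 0 ≤ Y a t := by
  rw [← hY.zero a]
  exact hY.mono a (left_mem_Icc.2 (ht.1.trans ht.2)) ht ht.1

section UniformLimit

variable {T t : ℝ} {f : ℕ → Species → ℝ → ℝ} {Y : Species → ℝ → ℝ}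

lemma eventually_forall_abs_sub_le
    (hlim : ∀ a, TendstoUniformlyOn (fun k => f k a) (Y a) atTop (Icc 0 t)) {d : ℝ} (hd : 0 < d) :
    ∀ᶠ k in atTop, ∀ a, ∀ s ∈ Icc 0 t, |Y a s - f k a s| ≤ d := by
  refine eventually_all.2 fun a => ?_
  filter_upwards [Metric.tendstoUniformlyOn_iff.1 (hlim a) d hd] with k hk s hs using (hk s hs).le

lemma tendstoUniformly_fluidLevel (ht : 0 ≤ t) (hf : ∀ k a, ∀ s ∈ Icc 0 t, 0 ≤ f k a s)
    (hY : ∀ a, ∀ s ∈ Icc 0 t, 0 ≤ Y a s)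
    (hlim : ∀ a, TendstoUniformlyOn (fun k => f k a) (Y a) atTop (Icc 0 t)) :
    TendstoUniformly (fun k x => fluidLevel (f k) x t) (fun x => fluidLevel Y x t) atTop := by
  refine Metric.tendstoUniformly_iff.2 fun ε hε => ?_
  filter_upwards [eventually_forall_abs_sub_le hlim (by positivity : 0 < ε / 51)] with k hk x
  have h := dist1_fluidLevel_le ht hY (hf k) hk x x
  simp only [dist1, sub_self, abs_zero, Finset.sum_const_zero] at h
  refine (dist_le_dist1 _ _).trans_lt (h.trans_lt ?_)
  linarith

lemma tendstoUniformly_outflow (ht : 0 ≤ t) (hf : ∀ k a, ∀ s ∈ Icc 0 t, 0 ≤ f k a s)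
    (hY : ∀ a, ∀ s ∈ Icc 0 t, 0 ≤ Y a s)
    (hlim : ∀ a, TendstoUniformlyOn (fun k => f k a) (Y a) atTop (Icc 0 t)) (a : Species) :
    TendstoUniformly (fun k x => outflow (f k) x t a) (fun x => outflow Y x t a) atTop := by
  refine Metric.tendstoUniformly_iff.2 fun ε hε => ?_
  filter_upwards [eventually_forall_abs_sub_le hlim (by positivity : 0 < ε / 52)] with k hk x
  have h := abs_outflow_sub_le ht hY (hf k) hk x x a
  simp only [dist1, sub_self, abs_zero, Finset.sum_const_zero] at h
  rw [Real.dist_eq]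
  linarith

end UniformLimit

section Limit

variable {t : ℝ} {n : ℕ → ℕ} {p : ℕ → ℝ → ProbabilityMeasure Config}
  {μ₀ : ProbabilityMeasure State} {Y : Species → ℝ → ℝ}

lemma tendsto_integral_scaled (hn : ∀ k, 0 < n k) (hn' : Tendsto n atTop atTop)
    (hp : ∀ k, IsNLMP (p k)) (ht : 0 ≤ t) (hY : ∀ a, ∀ s ∈ Icc 0 t, 0 ≤ Y a s)
    (hlim : ∀ a, TendstoUniformlyOn (fun k => scaledInflow (n k) (p k) a) (Y a) atTop (Icc 0 t))
    (hinit : Tendsto (fun k => krov (scaled (n k) (p k 0)) μ₀) atTop (𝓝 0))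
    {M L : ℝ} {g : State → ℝ} (hg : IsTest M L g) :
    Tendsto (fun k => ∫ x, g x ∂(scaled (n k) (p k (n k * t)) : Measure State)) atTop
      (𝓝 (∫ x, g (fluidLevel Y x t) ∂(μ₀ : Measure State))) := by
  have hYk : ∀ k a, ∀ s ∈ Icc 0 t, 0 ≤ scaledInflow (n k) (p k) a s := fun k a s hs =>
    scaledInflow_nonneg (hp k) a hs.1
  have hfluid := (isTest_comp_fluidLevel hg ht hY).tendsto_integral_of_tendstoUniformly
    (fun k => isTest_comp_fluidLevel hg ht (hYk k)) (hg.uniformContinuous.comp_tendstoUniformly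
      (tendstoUniformly_fluidLevel ht hYk hY hlim)) hinit
  have herror := squeeze_zero_norm
    (fun k => (Real.norm_eq_abs _).trans_le (abs_integral_scaled_sub_le (hp k) (hn k) hg ht))
    (((tendsto_sqrt_mul_div 15 1350 t).comp hn').const_mul L |>.trans_eq (by rw [mul_zero]))
  simpa using herror.add hfluid

lemma tendsto_scaledDepartures (hn : ∀ k, 0 < n k) (hn' : Tendsto n atTop atTop)
    (hp : ∀ k, IsNLMP (p k)) (ht : 0 ≤ t) (hY : ∀ a, ∀ s ∈ Icc 0 t, 0 ≤ Y a s)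
    (hlim : ∀ a, TendstoUniformlyOn (fun k => scaledInflow (n k) (p k) a) (Y a) atTop (Icc 0 t))
    (hinit : Tendsto (fun k => krov (scaled (n k) (p k 0)) μ₀) atTop (𝓝 0)) (a : Species) :
    Tendsto (fun k => scaledDepartures (n k) (p k) a t) atTop
      (𝓝 (∫ x, clamp (10 * t) (outflow Y x t a) ∂(μ₀ : Measure State))) := by
  have hK : 0 ≤ 10 * t := by positivity
  have hYk : ∀ k a, ∀ s ∈ Icc 0 t, 0 ≤ scaledInflow (n k) (p k) a s := fun k a s hs =>
    scaledInflow_nonneg (hp k) a hs.1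
  have hclamp : UniformContinuous (clamp (10 * t)) := (LipschitzWith.of_dist_le_mul (K := 1)
    fun x y => by simpa [Real.dist_eq] using abs_clamp_sub_le _ x y).uniformContinuous
  have hfluid := (isTest_clamp_outflow hK ht hY a).tendsto_integral_of_tendstoUniformly
    (fun k => isTest_clamp_outflow hK ht (hYk k) a) (hclamp.comp_tendstoUniformly
      (tendstoUniformly_outflow ht hYk hY hlim a)) hinit
  have herror := squeeze_zero_norm
    (fun k => (Real.norm_eq_abs _).trans_le (abs_scaledDepartures_sub_le (hp k) (hn k) a ht))
    ((tendsto_sqrt_mul_div 15 1350 t).comp hn')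
  simpa using herror.add hfluid

end Limit

lemma ae_clamp_outflow_eq {μ₀ : ProbabilityMeasure State} {Y : Species → ℝ → ℝ} {t : ℝ}
    (hμ₀ : ∀ᵐ x ∂(μ₀ : Measure State), x ∈ orthant) (ht : 0 ≤ t)
    (hY : ∀ a, ∀ s ∈ Icc 0 t, 0 ≤ Y a s) (a : Species) :
    (fun x => clamp (10 * t) (outflow Y x t a)) =ᵐ[(μ₀ : Measure State)]
      fun x => outflow Y x t a := by
  filter_upwards [hμ₀] with x hx using clamp_of_abs_le (abs_outflow_le ht hY hx a)

lemma isClosedFlow_of_tendsto {T : ℝ} {n : ℕ → ℕ} {p : ℕ → ℝ → ProbabilityMeasure Config}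
    {μ₀ : ProbabilityMeasure State} {Y : Species → ℝ → ℝ} (hp : ∀ k, IsNLMP (p k))
    (hint : ∀ t ∈ Icc 0 T, ∀ a, Integrable (fun x => outflow Y x t a) (μ₀ : Measure State))
    (hin : ∀ t ∈ Icc 0 T, ∀ a,
      Tendsto (fun k => scaledInflow (n k) (p k) a t) atTop (𝓝 (Y a t)))
    (hout : ∀ t ∈ Icc 0 T, ∀ a, Tendsto (fun k => scaledDepartures (n k) (p k) a t) atTop
      (𝓝 (∫ x, outflow Y x t a ∂(μ₀ : Measure State)))) : IsClosedFlow T μ₀ Y where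
  integrable := hint
  eq_O t ht := by
    rw [integral_add (hint t ht AB) (hint t ht BA)]
    exact tendsto_nhds_unique (hin t ht O) (((hout t ht AB).add (hout t ht BA)).congr
      fun k => (scaledInflow_O (hp k) t).symm)
  eq_A t ht := tendsto_nhds_unique (hin t ht A) (((hout t ht O).const_mul (1 / 2)).congr
    fun k => (scaledInflow_A (p k) (n k) t).symm)
  eq_B t ht := tendsto_nhds_unique (hin t ht B) (((hout t ht O).const_mul (1 / 2)).congr
    fun k => (scaledInflow_B (p k) (n k) t).symm)
  eq_AB t ht := tendsto_nhds_unique (hin t ht AB) (hout t ht A)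
  eq_BA t ht := tendsto_nhds_unique (hin t ht BA) (hout t ht B)

lemma eq_map_fluidLevel {μ₀ μₜ : ProbabilityMeasure State} {Y : Species → ℝ → ℝ} {t : ℝ}
    (hmeas : Measurable fun x => fluidLevel Y x t)
    (h : ∀ M L g, IsTest M L g → ∫ x, g x ∂(μₜ : Measure State)
      = ∫ x, g (fluidLevel Y x t) ∂(μ₀ : Measure State)) :
    (μₜ : Measure State) = (μ₀ : Measure State).map fun x => fluidLevel Y x t := by
  have heq : μₜ = μ₀.map (f := fun x => fluidLevel Y x t) hmeas.aemeasurable :=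
    eq_of_forall_isTest fun M L g hg => (h M L g hg).trans
      (integral_map hmeas.aemeasurable hg.measurable.aestronglyMeasurable).symm
  exact congrArg (fun P : ProbabilityMeasure State => (P : Measure State)) heq

theorem isFluidTrajectory_of_tendsto {T : ℝ} (hT : 0 ≤ T) {n : ℕ → ℕ}
    {p : ℕ → ℝ → ProbabilityMeasure Config} (hn : ∀ k, 0 < n k) (hn' : Tendsto n atTop atTop)
    (hp : ∀ k, IsNLMP (p k)) {m : ℝ → ProbabilityMeasure State}
    (hm : ∀ t ∈ Icc 0 T, Tendsto (fun k => krov (scaled (n k) (p k (n k * t))) (m t)) atTop (𝓝 0))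
    {Y : Species → ℝ → ℝ} (hY : IsNetInflow T Y)
    (hlim : ∀ a, TendstoUniformlyOn (fun k => scaledInflow (n k) (p k) a) (Y a) atTop (Icc 0 T)) :
    IsFluidTrajectory T m := by
  have hinit : Tendsto (fun k => krov (scaled (n k) (p k 0)) (m 0)) atTop (𝓝 0) := by
    simpa using hm 0 (left_mem_Icc.2 hT)
  have horthant : ∀ t ∈ Icc 0 T, ∀ᵐ x ∂(m t : Measure State), x ∈ orthant :=
    fun t ht => ae_mem_orthant_of_krov (hm t ht)
  have hYt : ∀ t ∈ Icc 0 T, ∀ a, ∀ s ∈ Icc 0 t, 0 ≤ Y a s :=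
    fun t ht a s hs => hY.nonneg ⟨hs.1, hs.2.trans ht.2⟩ a
  have hlimt : ∀ t ∈ Icc 0 T, ∀ a, TendstoUniformlyOn (fun k => scaledInflow (n k) (p k) a) (Y a)
      atTop (Icc 0 t) := fun t ht a => (hlim a).mono (Icc_subset_Icc_right ht.2)
  have hclamp := fun t (ht : t ∈ Icc 0 T) =>
    ae_clamp_outflow_eq (horthant 0 (left_mem_Icc.2 hT)) ht.1 (hYt t ht)
  refine ⟨horthant, Y, hY, isClosedFlow_of_tendsto hp (fun t ht a => ?_)
    (fun t ht a => (hlim a).tendsto_at ht) (fun t ht a => ?_), fun t ht => ?_⟩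
  · exact ((isTest_clamp_outflow (mul_nonneg (by norm_num) ht.1) ht.1 (hYt t ht)
      a).integrable _).congr (hclamp t ht a)
  · rw [← integral_congr_ae (hclamp t ht a)]
    exact tendsto_scaledDepartures hn hn' hp ht.1 (hYt t ht) (hlimt t ht) hinit a
  · refine eq_map_fluidLevel (measurable_fluidLevel ht.1 (hYt t ht)) fun M L g hg =>
      tendsto_nhds_unique (hg.tendsto_integral (hm t ht)) ?_
    exact tendsto_integral_scaled hn hn' hp ht.1 (hYt t ht) (hlimt t ht) hinit hg

end EulerLimit

end

theorem theorem5p1 (T : ℝ) (hT : 0 ≤ T)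
    (p : ℕ → ℝ → ProbabilityMeasure Config) (hp : ∀ N : ℕ, 0 < N → IsNLMP (p N))
    (μ : ProbabilityMeasure State)
    (hμ : Tendsto (fun N : ℕ => krov (scaled N (p N 0)) μ) atTop (𝓝 0))
    (m : ℝ → ProbabilityMeasure State)
    (hm : IsLimitPoint T (fun N t => scaled N (p N (N * t))) m) :
    m 0 = μ ∧ IsFluidTrajectory T m := by
  obtain ⟨φ, hφ, hconv⟩ := hm
  refine ⟨krov_limit_unique (by simpa using hconv 0 (left_mem_Icc.2 hT))
    (hμ.comp hφ.tendsto_atTop), ?_⟩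
  have hpos : ∀ k, 0 < φ (k + 1) := fun k => k.succ_pos.trans_le (hφ.id_le _)
  have hp' : ∀ k, IsNLMP (p (φ (k + 1))) := fun k => hp _ (hpos k)
  obtain ⟨ψ, hψ, Y, hY, hlim⟩ := exists_subseq_tendsto_netInflow hT
    (f := fun k => scaledInflow (φ (k + 1)) (p (φ (k + 1)))) (fun _ => scaledInflow_zero)
    (fun k => monotone_scaledInflow (hp' k)) fun k => lipschitzWith_scaledInflow (hp' k) (hpos k)
  have hsucc : Tendsto (fun k => ψ k + 1) atTop atTop :=
    (tendsto_add_atTop_nat 1).comp hψ.tendsto_atTop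
  exact isFluidTrajectory_of_tendsto hT (fun k => hpos (ψ k)) (hφ.tendsto_atTop.comp hsucc)
    (fun k => hp' (ψ k)) (fun t ht => (hconv t ht).comp hsucc) hY hlim
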